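/- **Setting.** In the best-choice prophet secretary problem, $x_1,\dots,x_n$ ($n\ge 1$) are drawn independently from known atomless distributions $D_1,\dots,D_n$ on $\mathbb R$ and revealed in a uniformly random order $x_{\pi_1},\dots,x_{\pi_n}$; at each step one either chooses the revealed value irrevocably and stops, or continues. An algorithm succeeds if it chooses a value equal to $\max_i x_i$. The distributions satisfy the *no $\varepsilon$-superstars assumption* if $\Pr[i=\arg\max_j x_j]\le\varepsilon$ for every $i$. Given real thresholds $\tau_1,\tau_2,\dots$, the *plain* threshold algorithm chooses the first value that is at least its threshold $\tau_k$ ($k$ being the step); the *record* threshold algorithm (the multi-threshold rule of Gilbert and Mosteller) chooses the first value that is at least its threshold $\tau_k$ and is not exceeded by any earlier value. In the i.i.d. setting, $m$ values are drawn independently from one atomless distribution $\mu$. **Theorem.** For $\gamma\in(0,1)$ put $$\varepsilon(\gamma)=\frac{\gamma^{10}}{24\log(2/\gamma^2)},\qquad m(\gamma)=\lceil 2/\gamma^2\rceil .$$ 1. Let $\gamma\in(0,1)$, let $\mu$ be an atomless distribution, and suppose that a (plain, respectively record) threshold algorithm selects the maximum of $m(\gamma)$ i.i.d. values from $\mu$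 with probability at least $\alpha$. Then for all $n\ge1$ and all atomless $D_1,\dots,D_n$ that satisfy the no $\varepsilon(\gamma)$-superstars assumption there is a (plain, respectively record) threshold algorithm, with thresholds $\tau_1,\dots,\tau_n\in\mathbb R$, that selects the maximum in the best-choice prophet secretary problem with probability at least $\alpha-13\gamma$. 2. The supremum over all thresholds of the success probability of record threshold algorithms on $m$ i.i.d. values from an atomless distribution $\mu$ converges, as $m\to\infty$, to a constant $\alpha_{GM}\ge 0.5801$ that does not depend on $\mu$ (the Gilbert–Mosteller bound), and for every $\gamma\in(0,1)$, every $n\ge1$ and all atomless $D_1,\dots,D_n$ that satisfy the no $\varepsilon(\gamma)$-superstars assumption there is a record threshold algorithm that selects the maximum in the best-choice prophet secretary problem with probability at least $\alpha_{GM}-13\gamma$. -/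

import Mathlib

open MeasureTheory Filter Topology

/-- The two usual readings of a threshold algorithm.  `plain`: choose a value if and only if it
reaches the threshold of its step.  `record`: choose a value if and only if it reaches the threshold
of its step and is a candidate, i.e. no earlier value exceeds it (the multi-threshold rule of
Gilbert and Mosteller). -/
inductive ThresholdRule : Type
  | plain
  | record

/-- With thresholds `τ`, the rule is willing to choose the value `x k` that is observed at step `k`.
This depends only on the values observed up to step `k`. -/
def ThresholdRule.Accepts {m : ℕ} (r : ThresholdRule) (τ x : Fin m → ℝ) (k : Fin m) : Prop :=
  match r with
  | .plain => τ k ≤ x k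
  | .record => τ k ≤ x k ∧ ∀ j < k, x j ≤ x k

/-- The process stops at step `k`: the value `x k` is accepted and no earlier value is. -/
def ThresholdRule.StopsAt {m : ℕ} (r : ThresholdRule) (τ x : Fin m → ℝ) (k : Fin m) : Prop :=
  r.Accepts τ x k ∧ ∀ j < k, ¬ r.Accepts τ x j

/-- On the observed sequence `x`, a value is chosen and it is the maximum of the sequence. -/
def ThresholdRule.SelectsMax {m : ℕ} (r : ThresholdRule) (τ x : Fin m → ℝ) : Prop :=
  ∃ k, r.StopsAt τ x k ∧ ∀ j, x j ≤ x k

/-- The probability that the threshold algorithm selects the maximum of `m` i.i.d. values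
with distribution `μ`. -/
noncomputable def iidSuccess (r : ThresholdRule) {m : ℕ} (μ : Measure ℝ) (σ : Fin m → ℝ) : ℝ :=
  (Measure.pi fun _ : Fin m => μ).real {x | r.SelectsMax σ x}

/-- The probability that the threshold algorithm selects the maximum in the best-choice prophet
secretary problem: the values `x i` are drawn independently from `D i` and presented in a uniformly
random order, so that step `k` reveals `x (π k)`. -/
noncomputable def secretarySuccess (r : ThresholdRule) {n : ℕ} (D : Fin n → Measure ℝ)
    (τ : Fin n → ℝ) : ℝ :=
  (∑ π : Equiv.Perm (Fin n), (Measure.pi D).real {x | r.SelectsMax τ (fun k => x (π k))}) /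
    (n.factorial : ℝ)

/-- The no `ε`-superstars assumption: no single value is the largest with probability more
than `ε`. -/
def NoSuperstars (ε : ℝ) {n : ℕ} (D : Fin n → Measure ℝ) : Prop :=
  ∀ i, (Measure.pi D).real {x | ∀ j, x j ≤ x i} ≤ ε

/-- The superstar bound `γ ^ 10 / (24 log (2 / γ ^ 2))`. -/
noncomputable def superstarBound (γ : ℝ) : ℝ :=
  γ ^ 10 / (24 * Real.log (2 / γ ^ 2))

/-- The number `1 / q = 2 / γ ^ 2` of i.i.d. values, rounded up when it is not an integer. -/
noncomputable def iidCount (γ : ℝ) : ℕ :=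
  ⌈2 / γ ^ 2⌉₊

/-- The optimal probability of selecting the maximum of `m` i.i.d. values with distribution `μ` by
a Gilbert-Mosteller multi-threshold rule. -/
noncomputable def iidOptimum (μ : Measure ℝ) (m : ℕ) : ℝ :=
  ⨆ σ : Fin m → ℝ, iidSuccess ThresholdRule.record μ σ

open ProbabilityTheory

/-!
Replace `m` i.i.d. values by the items of the secretary problem as follows. Cut time into `m` blocks
and send each item to a uniformly random block; this is consistent with a uniformly random order of
arrival. If `G` is the distribution function of the overall maximum, let every step in block `k` use
the quantile of `G` at level `s k ^ m`. A bound on an item in a random block then holds with a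
probability that is an arithmetic mean over the blocks, which by AM–GM dominates the geometric mean
that occurs for `m` i.i.d. uniform values with thresholds `s`; hence the blocks do at least as well
as these, except when a second item of the same block interferes, which costs at most `1 / m`.

For record rules the i.i.d. success probability is optimized by backward induction over the steps,
with value function `optValue`, independent of the distribution. The comparison applied to i.i.d.
items shows that optimal values for different numbers of items differ by at most `1 / m`, whence the
limit; its lower bound comes from explicit thresholds whose values are Riemann sums.
-/

section Integrals

variable {f : ℝ → ℝ}

lemma continuous_integral_left (hf : Continuous f) (b : ℝ) :
    Continuous fun a => ∫ x in a..b, f x := by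
  simp_rw [intervalIntegral.integral_symm b]
  exact (intervalIntegral.continuous_primitive (fun _ _ => hf.intervalIntegrable _ _) b).neg

lemma integral_pow_mul_integral (hf : Continuous f) (k : ℕ) (a b : ℝ) :
    (k + 1) * ∫ y in (0 : ℝ)..a, y ^ k * ∫ z in y..b, f z =
      a ^ (k + 1) * (∫ z in a..b, f z) + ∫ y in (0 : ℝ)..a, y ^ (k + 1) * f y := by
  have hpow (y : ℝ) : HasDerivAt (fun y => y ^ (k + 1)) ((k + 1) * y ^ k) y := by
    simpa using hasDerivAt_pow (k + 1) y
  have hint (y : ℝ) : HasDerivAt (fun y => ∫ z in y..b, f z) (-f y) y :=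
    intervalIntegral.integral_hasDerivAt_left (hf.intervalIntegrable _ _)
      (hf.stronglyMeasurableAtFilter _ _) hf.continuousAt
  have hparts := intervalIntegral.integral_mul_deriv_eq_deriv_mul
    (fun y _ => hpow y) (fun y _ => hint y)
    (Continuous.intervalIntegrable (by fun_prop) 0 a) (hf.neg.intervalIntegrable 0 a)
  simp only [mul_neg, intervalIntegral.integral_neg, mul_assoc,
    intervalIntegral.integral_const_mul, zero_pow k.succ_ne_zero, zero_mul, sub_zero] at hparts
  linarith

lemma integral_min_pow_mul (hf : Continuous f) (k : ℕ) {a b : ℝ} (ha : 0 ≤ a) (hab : a ≤ b) :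
    ∫ y in (0 : ℝ)..b, min a y ^ k * f y =
      (∫ y in (0 : ℝ)..a, y ^ k * f y) + a ^ k * ∫ z in a..b, f z := by
  have hc : Continuous fun y => min a y ^ k * f y := by fun_prop
  rw [← intervalIntegral.integral_add_adjacent_intervals (hc.intervalIntegrable 0 a)
    (hc.intervalIntegrable a b), ← intervalIntegral.integral_const_mul]
  congr 1 <;> refine intervalIntegral.integral_congr fun y hy => ?_
  · rw [Set.uIcc_of_le ha] at hy
    simp only [min_eq_right hy.2]
  · rw [Set.uIcc_of_le hab] at hy
    simp only [min_eq_left hy.1]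

end Integrals

/-- The optimal probability of selecting the maximum of a sequence of i.i.d. uniform values by a
record rule, when `r` values are still to come and the largest value so far, which has been passed
over, is `v`. If the next value is `y ≥ v`, then choosing it wins with probability `y ^ r`. -/
noncomputable def optValue : ℕ → ℝ → ℝ
  | 0, _ => 0
  | r + 1, v => v * optValue r v + ∫ y in v..1, max (y ^ r) (optValue r y)

/-- The optimal probability of success when a uniform value `y` that exceeds all earlier ones is
revealed and `r` values are still to come. -/
noncomputable def candidateValue (r : ℕ) (y : ℝ) : ℝ :=
  max (y ^ r) (optValue r y)

section OptimalValue

variable {r : ℕ} {v : ℝ}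

lemma optValue_succ (r : ℕ) (v : ℝ) :
    optValue (r + 1) v = v * optValue r v + ∫ y in v..1, candidateValue r y :=
  rfl

lemma pow_le_candidateValue (r : ℕ) (y : ℝ) : y ^ r ≤ candidateValue r y :=
  le_max_left _ _

lemma optValue_le_candidateValue (r : ℕ) (y : ℝ) : optValue r y ≤ candidateValue r y :=
  le_max_right _ _

@[fun_prop]
lemma continuous_optValue (r : ℕ) : Continuous (optValue r) := by
  induction r with
  | zero => exact continuous_const
  | succ r ih =>
    exact (continuous_id.mul ih).add (continuous_integral_left ((continuous_pow r).max ih) 1)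

@[fun_prop]
lemma continuous_candidateValue (r : ℕ) : Continuous (candidateValue r) :=
  (continuous_pow r).max (continuous_optValue r)

@[simp]
lemma optValue_one (r : ℕ) : optValue r 1 = 0 := by
  induction r with
  | zero => rfl
  | succ r ih => simp [optValue_succ, ih]

lemma pow_integral_le_integral_candidateValue (r : ℕ) (hv : v ≤ 1) :
    (1 - v ^ (r + 1)) / (r + 1) ≤ ∫ y in v..1, candidateValue r y := by
  have hmono := intervalIntegral.integral_mono_on (μ := volume) hv
    ((continuous_pow r).intervalIntegrable v 1)
    ((continuous_candidateValue r).intervalIntegrable v 1) fun y _ => pow_le_candidateValue r y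
  simpa [integral_pow] using hmono

lemma mul_optValue_add_le (r : ℕ) (hv : v ≤ 1) :
    v * optValue r v + (1 - v ^ (r + 1)) / (r + 1) ≤ optValue (r + 1) v := by
  rw [optValue_succ]
  gcongr
  exact pow_integral_le_integral_candidateValue r hv

lemma optValue_nonneg (r : ℕ) (hv : v ∈ Set.Icc (0 : ℝ) 1) : 0 ≤ optValue r v := by
  induction r with
  | zero => exact le_rfl
  | succ r ih =>
    have hpow : v ^ (r + 1) ≤ 1 := pow_le_one₀ hv.1 hv.2
    have hgain : 0 ≤ (1 - v ^ (r + 1)) / ((r : ℝ) + 1) := by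
      have := sub_nonneg.2 hpow
      positivity
    linarith [mul_optValue_add_le r hv.2, mul_nonneg hv.1 ih]

lemma antitoneOn_optValue (r : ℕ) : AntitoneOn (optValue r) (Set.Icc 0 1) := by
  induction r with
  | zero => exact antitoneOn_const
  | succ r ih =>
    intro v hv w hw hvw
    have hc := continuous_candidateValue r
    have hsplit := intervalIntegral.integral_add_adjacent_intervals (μ := volume)
      (hc.intervalIntegrable v w) (hc.intervalIntegrable w 1)
    have hbetween : (w - v) * optValue r w ≤ ∫ y in v..w, candidateValue r y := by
      have hmono := intervalIntegral.integral_mono_on (μ := volume) hvw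
        (intervalIntegrable_const (c := optValue r w)) (hc.intervalIntegrable v w) fun y hy =>
          (ih ⟨hv.1.trans hy.1, hy.2.trans hw.2⟩ hw hy.2).trans (optValue_le_candidateValue r y)
      simpa using hmono
    have hpassed := mul_le_mul_of_nonneg_left (ih hv hw hvw) hv.1
    simp only [optValue_succ]
    linarith

lemma sum_le_optValue (r : ℕ) (hv : v ∈ Set.Icc (0 : ℝ) 1) :
    ∑ i ∈ Finset.range r, (v ^ (r - 1 - i) - v ^ r) / (i + 1) ≤ optValue r v := by
  induction r with
  | zero => simp [optValue]
  | succ r ih =>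
    have hfactor : ∑ i ∈ Finset.range r, (v ^ (r + 1 - 1 - i) - v ^ (r + 1)) / ((i : ℝ) + 1) =
        v * ∑ i ∈ Finset.range r, (v ^ (r - 1 - i) - v ^ r) / ((i : ℝ) + 1) := by
      rw [Finset.mul_sum]
      refine Finset.sum_congr rfl fun i hi => ?_
      rw [show r + 1 - 1 - i = (r - 1 - i) + 1 by have := Finset.mem_range.1 hi; omega]
      ring
    calc ∑ i ∈ Finset.range (r + 1), (v ^ (r + 1 - 1 - i) - v ^ (r + 1)) / ((i : ℝ) + 1)
        = v * ∑ i ∈ Finset.range r, (v ^ (r - 1 - i) - v ^ r) / ((i : ℝ) + 1) +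
            (1 - v ^ (r + 1)) / (r + 1) := by
          rw [Finset.sum_range_succ, hfactor, Nat.add_sub_cancel, Nat.sub_self, pow_zero]
      _ ≤ v * optValue r v + (1 - v ^ (r + 1)) / (r + 1) := by
          gcongr
          exact hv.1
      _ ≤ optValue (r + 1) v := mul_optValue_add_le r hv.2

lemma integral_pow_mul_optValue_succ (k r : ℕ) {a : ℝ} (ha : a ∈ Set.Icc (0 : ℝ) 1) :
    (k + 1) * ∫ y in (0 : ℝ)..a, y ^ k * optValue (r + 1) y =
      ((k + 1) * ∫ y in (0 : ℝ)..a, y ^ (k + 1) * optValue r y) +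
        ∫ y in (0 : ℝ)..1, min a y ^ (k + 1) * candidateValue r y := by
  have hc := continuous_candidateValue r
  have hi := continuous_integral_left hc 1
  have hsplit : ∫ y in (0 : ℝ)..a, y ^ k * optValue (r + 1) y =
      (∫ y in (0 : ℝ)..a, y ^ (k + 1) * optValue r y) +
        ∫ y in (0 : ℝ)..a, y ^ k * ∫ z in y..1, candidateValue r z := by
    rw [← intervalIntegral.integral_add (Continuous.intervalIntegrable (by fun_prop) _ _)
      (Continuous.intervalIntegrable (by fun_prop) _ _)]
    simp only [optValue_succ, pow_succ, mul_add, mul_assoc]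
  rw [hsplit, mul_add, integral_pow_mul_integral hc, integral_min_pow_mul hc _ ha.1 ha.2]
  ring

end OptimalValue

/-- The indifference point of the optimal record rule: with `r` values still to come, a candidate
`y` is worth choosing if and only if it is at least `optThreshold r`. -/
noncomputable def optThreshold (r : ℕ) : ℝ :=
  sInf {v ∈ Set.Icc (0 : ℝ) 1 | optValue r v ≤ v ^ r}

section OptThreshold

variable {r : ℕ} {y : ℝ}

lemma bddBelow_optValue_le_pow (r : ℕ) :
    BddBelow {v ∈ Set.Icc (0 : ℝ) 1 | optValue r v ≤ v ^ r} :=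
  bddBelow_Icc.mono fun _ hv => hv.1

lemma optThreshold_mem (r : ℕ) :
    optThreshold r ∈ {v ∈ Set.Icc (0 : ℝ) 1 | optValue r v ≤ v ^ r} :=
  (isClosed_Icc.inter (isClosed_le (continuous_optValue r) (continuous_pow r))).csInf_mem
    ⟨1, by simp⟩ (bddBelow_optValue_le_pow r)

lemma optThreshold_mem_Icc (r : ℕ) : optThreshold r ∈ Set.Icc (0 : ℝ) 1 :=
  (optThreshold_mem r).1

lemma candidateValue_eq_pow (hy : y ∈ Set.Icc (optThreshold r) 1) :
    candidateValue r y = y ^ r := by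
  have hmem := optThreshold_mem r
  refine max_eq_left ?_
  calc optValue r y ≤ optValue r (optThreshold r) :=
        antitoneOn_optValue r hmem.1 ⟨hmem.1.1.trans hy.1, hy.2⟩ hy.1
    _ ≤ optThreshold r ^ r := hmem.2
    _ ≤ y ^ r := pow_le_pow_left₀ hmem.1.1 hy.1 r

lemma candidateValue_eq_optValue (hy : y ∈ Set.Ico 0 (optThreshold r)) :
    candidateValue r y = optValue r y := by
  refine max_eq_right ?_
  by_contra! hlt
  exact (csInf_le (bddBelow_optValue_le_pow r)
    ⟨⟨hy.1, hy.2.le.trans (optThreshold_mem_Icc r).2⟩, hlt.le⟩).not_gt hy.2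

lemma monotone_optThreshold : Monotone optThreshold := by
  refine monotone_nat_of_le_succ fun r =>
    csInf_le_csInf (bddBelow_optValue_le_pow r) ⟨_, optThreshold_mem (r + 1)⟩ fun v hv => ⟨hv.1, ?_⟩
  obtain ⟨⟨hv0, hv1⟩, hle⟩ := hv
  have hstep := (mul_optValue_add_le r hv1).trans hle
  rcases hv0.eq_or_lt with rfl | hpos
  · have : (0 : ℝ) < ((r : ℝ) + 1)⁻¹ := by positivity
    rw [zero_mul, zero_add, zero_pow r.succ_ne_zero, sub_zero, one_div] at hstep
    linarith
  · have hgain : 0 ≤ (1 - v ^ (r + 1)) / ((r : ℝ) + 1) :=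
      div_nonneg (sub_nonneg.2 (pow_le_one₀ hv0 hv1)) (by positivity)
    refine le_of_mul_le_mul_left ?_ hpos
    rw [← pow_succ']
    linarith

lemma integral_mul_candidateValue {g : ℝ → ℝ} (hg : Continuous g) (r : ℕ) :
    ∫ y in (0 : ℝ)..1, g y * candidateValue r y =
      (∫ y in (0 : ℝ)..optThreshold r, g y * optValue r y) +
        ∫ y in optThreshold r..1, g y * y ^ r := by
  obtain ⟨h0, h1⟩ := optThreshold_mem_Icc r
  have hc : Continuous fun y => g y * candidateValue r y := by fun_prop
  rw [← intervalIntegral.integral_add_adjacent_intervals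
    (hc.intervalIntegrable 0 (optThreshold r)) (hc.intervalIntegrable _ 1)]
  congr 1 <;> refine intervalIntegral.integral_congr_uIoo fun y hy => ?_
  · rw [Set.uIoo_of_le h0] at hy
    simp only [candidateValue_eq_optValue ⟨hy.1.le, hy.2⟩]
  · rw [Set.uIoo_of_le h1] at hy
    simp only [candidateValue_eq_pow ⟨hy.1.le, hy.2.le⟩]

end OptThreshold

/-- Given the thresholds `s 0 ≥ s 1 ≥ ⋯` of a record rule, the conditional probability that none of
the first `K` of a sequence of i.i.d. uniform values is chosen and all of them are at most `w`.
The largest of them, at the uniform position `J`, has to be at most `w` and below `s J`. -/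
noncomputable def skipProb (s : ℕ → ℝ) (K : ℕ) (w : ℝ) : ℝ :=
  if K = 0 then 1 else (∑ J ∈ Finset.range K, min (s J) w ^ K) / K

/-- The probability that the record rule with antitone thresholds `s 0 ≥ s 1 ≥ ⋯` selects the
maximum of `m` i.i.d. uniform values. The integration variable is the value chosen at step `K`. -/
noncomputable def recordValue (m : ℕ) (s : ℕ → ℝ) : ℝ :=
  ∑ K ∈ Finset.range m, ∫ w in (s K)..1, w ^ (m - 1 - K) * skipProb s K w

section RecordValue

lemma sum_integral_min_pow_mul_candidateValue {s : ℕ → ℝ} {k r : ℕ} (hk : k ≠ 0)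
    (hs : ∀ J < k, optThreshold r ≤ s J) :
    (∑ J ∈ Finset.range k, ∫ y in (0 : ℝ)..1, min (s J) y ^ k * candidateValue r y) / k =
      (∫ y in (0 : ℝ)..optThreshold r, y ^ k * optValue r y) +
        ∫ w in optThreshold r..1, w ^ r * skipProb s k w := by
  have hk' : (k : ℝ) ≠ 0 := Nat.cast_ne_zero.2 hk
  have hc (J : ℕ) : Continuous fun y => min (s J) y ^ k := by fun_prop
  simp only [integral_mul_candidateValue (hc _), Finset.sum_add_distrib, add_div]
  congr 1
  · have hmin : ∀ J ∈ Finset.range k,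
        ∫ y in (0 : ℝ)..optThreshold r, min (s J) y ^ k * optValue r y =
          ∫ y in (0 : ℝ)..optThreshold r, y ^ k * optValue r y := fun J hJ => by
      refine intervalIntegral.integral_congr fun y hy => ?_
      rw [Set.uIcc_of_le (optThreshold_mem_Icc r).1] at hy
      simp only [min_eq_right (hy.2.trans (hs J (Finset.mem_range.1 hJ)))]
    rw [Finset.sum_congr rfl hmin, Finset.sum_const, Finset.card_range, nsmul_eq_mul,
      mul_div_cancel_left₀ _ hk']
  · have hint (J : ℕ) : IntervalIntegrable (fun y => min (s J) y ^ k * y ^ r) volume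
        (optThreshold r) 1 := ((hc J).mul (continuous_pow r)).intervalIntegrable _ _
    rw [← intervalIntegral.integral_finsetSum fun J _ => hint J, ← intervalIntegral.integral_div]
    simp only [skipProb, if_neg hk, ← Finset.sum_mul]
    congr with y
    ring

lemma sum_integral_pow_mul_optValue_succ {s : ℕ → ℝ} (k r : ℕ)
    (hmem : ∀ J, s J ∈ Set.Icc (0 : ℝ) 1) (hle : ∀ J < k + 1, optThreshold r ≤ s J)
    (hlast : s (k + 1) = optThreshold r) :
    ∑ J ∈ Finset.range (k + 1), ∫ y in (0 : ℝ)..s J, y ^ k * optValue (r + 1) y =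
      (∫ w in optThreshold r..1, w ^ r * skipProb s (k + 1) w) +
        ∑ J ∈ Finset.range (k + 2), ∫ y in (0 : ℝ)..s J, y ^ (k + 1) * optValue r y := by
  have hstep (J : ℕ) : ∫ y in (0 : ℝ)..s J, y ^ k * optValue (r + 1) y =
      (∫ y in (0 : ℝ)..s J, y ^ (k + 1) * optValue r y) +
        (∫ y in (0 : ℝ)..1, min (s J) y ^ (k + 1) * candidateValue r y) / (k + 1 : ℕ) := by
    have := integral_pow_mul_optValue_succ k r (hmem J)
    push_cast
    field_simp
    linarith
  simp_rw [hstep]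
  rw [Finset.sum_add_distrib, ← Finset.sum_div,
    sum_integral_min_pow_mul_candidateValue k.succ_ne_zero hle,
    Finset.sum_range_succ (fun J => ∫ y in (0 : ℝ)..s J, y ^ (k + 1) * optValue r y) (k + 1), hlast]
  ring

lemma optValue_eq_sum_add_sum (m k : ℕ) (hk : k + 1 ≤ m) :
    optValue m 0 = (∑ K ∈ Finset.range (k + 1), ∫ w in optThreshold (m - 1 - K)..1,
        w ^ (m - 1 - K) * skipProb (fun K => optThreshold (m - 1 - K)) K w) +
      ∑ J ∈ Finset.range (k + 1), ∫ y in (0 : ℝ)..optThreshold (m - 1 - J),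
        y ^ k * optValue (m - (k + 1)) y := by
  induction k with
  | zero =>
    obtain ⟨m, rfl⟩ : ∃ m', m = m' + 1 := ⟨m - 1, by omega⟩
    have hsplit := integral_mul_candidateValue (g := 1) continuous_const m
    simp only [Pi.one_apply, one_mul] at hsplit
    simp only [optValue_succ, hsplit, skipProb, Finset.sum_range_one, zero_mul, zero_add, if_true,
      mul_one, pow_zero, one_mul, Nat.add_sub_cancel, Nat.sub_zero]
    rw [add_comm]
  | succ k ih =>
    obtain ⟨r, rfl⟩ : ∃ r, m = r + (k + 2) := ⟨m - (k + 2), by omega⟩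
    have hstep := sum_integral_pow_mul_optValue_succ
      (s := fun K => optThreshold (r + (k + 2) - 1 - K)) k r (fun J => optThreshold_mem_Icc _)
      (fun J hJ => monotone_optThreshold (by omega)) (by congr 1; omega)
    rw [ih (by omega), Finset.sum_range_succ _ (k + 1),
      show r + (k + 2) - (k + 1) = r + 1 by omega, show r + (k + 2) - 1 - (k + 1) = r by omega,
      show r + (k + 2) - (k + 1 + 1) = r by omega, hstep, add_assoc]

lemma optValue_eq_recordValue (m : ℕ) :
    optValue m 0 = recordValue m fun K => optThreshold (m - 1 - K) := by
  cases m with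
  | zero => simp [optValue, recordValue]
  | succ m =>
    rw [optValue_eq_sum_add_sum (m + 1) m le_rfl]
    simp [recordValue, optValue]

end RecordValue

section LowerBound

variable {u : ℕ → ℝ}

lemma le_integral_pow_mul_optValue_succ (k r : ℕ) {a b : ℝ} (hb : 0 ≤ b) (hba : b ≤ a)
    (ha : a ≤ 1) :
    b ^ (k + 1) * ((1 - b ^ (r + 1)) / (r + 1)) +
        (a ^ (k + 1) - b ^ (k + 1)) * optValue (r + 1) a +
        (k + 2) * ∫ y in (0 : ℝ)..b, y ^ (k + 1) * optValue r y ≤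
      (k + 1) * ∫ y in (0 : ℝ)..a, y ^ k * optValue (r + 1) y := by
  have hint {g : ℝ → ℝ} (hg : Continuous g) (c d : ℝ) : IntervalIntegrable g volume c d :=
    hg.intervalIntegrable c d
  have hsplit := intervalIntegral.integral_add_adjacent_intervals (μ := volume)
    (f := fun y => y ^ k * optValue (r + 1) y) (hint (by fun_prop) 0 b) (hint (by fun_prop) b a)
  have habove : (a ^ (k + 1) - b ^ (k + 1)) * optValue (r + 1) a ≤
      (k + 1) * ∫ y in b..a, y ^ k * optValue (r + 1) y := by
    have hmono := intervalIntegral.integral_mono_on (μ := volume) hba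
      (f := fun y => y ^ k * optValue (r + 1) a) (g := fun y => y ^ k * optValue (r + 1) y)
      (hint (by fun_prop) b a) (hint (by fun_prop) b a) fun y hy =>
        mul_le_mul_of_nonneg_left (antitoneOn_optValue (r + 1)
          ⟨hb.trans hy.1, hy.2.trans ha⟩ ⟨hb.trans hba, ha⟩ hy.2) (pow_nonneg (hb.trans hy.1) k)
    rw [intervalIntegral.integral_mul_const, integral_pow] at hmono
    calc _ = (k + 1) * ((a ^ (k + 1) - b ^ (k + 1)) / (k + 1) * optValue (r + 1) a) := by field_simp
      _ ≤ _ := mul_le_mul_of_nonneg_left hmono (by positivity)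
  have hstep := integral_pow_mul_optValue_succ k r ⟨hb, hba.trans ha⟩
  rw [integral_min_pow_mul (continuous_candidateValue r) _ hb (hba.trans ha)] at hstep
  have hpassed := intervalIntegral.integral_mono_on (μ := volume) hb
    (f := fun y => y ^ (k + 1) * optValue r y) (g := fun y => y ^ (k + 1) * candidateValue r y)
    (hint (by fun_prop) 0 b) (hint (by fun_prop) 0 b) fun y hy =>
      mul_le_mul_of_nonneg_left (optValue_le_candidateValue r y) (pow_nonneg hy.1 _)
  have hchosen := mul_le_mul_of_nonneg_left
    (pow_integral_le_integral_candidateValue r (hba.trans ha)) (pow_nonneg hb (k + 1))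
  rw [← hsplit, mul_add]
  linarith

lemma sum_le_integral_pow_mul_optValue (hu : Monotone u) (hmem : ∀ i, u i ∈ Set.Icc (0 : ℝ) 1)
    (k r : ℕ) :
    ∑ i ∈ Finset.range r, (u i ^ (k + r - i) * ((1 - u i ^ (i + 1)) / (i + 1)) +
        (u (i + 1) ^ (k + r - i) - u i ^ (k + r - i)) * optValue (i + 1) (u (i + 1))) ≤
      (k + 1) * ∫ y in (0 : ℝ)..u r, y ^ k * optValue r y := by
  induction r generalizing k with
  | zero => simp [optValue]
  | succ r ih =>
    have hstep := le_integral_pow_mul_optValue_succ k r (hmem r).1 (hu r.le_succ) (hmem (r + 1)).2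
    have hrest := ih (k + 1)
    rw [Finset.sum_range_succ, show k + (r + 1) - r = k + 1 by omega]
    rw [show k + 1 + r = k + (r + 1) by omega] at hrest
    push_cast at hrest
    linarith

/-- The summands come from the rule that uses the threshold `u i` when `i` values are still to come:
the first is the gain when a value above the threshold is chosen at once, the second when the
threshold drops below the largest value that was passed over. -/
lemma sum_add_sum_le_optValue (hu : Monotone u) (hmem : ∀ i, u i ∈ Set.Icc (0 : ℝ) 1) (m : ℕ) :
    (∑ i ∈ Finset.range (m + 1), u i ^ (m - i) * ((1 - u i ^ (i + 1)) / (i + 1))) +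
        ∑ i ∈ Finset.range m,
          (u (i + 1) ^ (m - i) - u i ^ (m - i)) * optValue (i + 1) (u (i + 1)) ≤
      optValue (m + 1) 0 := by
  have hc := continuous_candidateValue m
  have hsplit := intervalIntegral.integral_add_adjacent_intervals (μ := volume)
    (hc.intervalIntegrable 0 (u m)) (hc.intervalIntegrable (u m) 1)
  have hpassed := intervalIntegral.integral_mono_on (μ := volume) (hmem m).1
    ((continuous_optValue m).intervalIntegrable _ _) (hc.intervalIntegrable _ _)
    fun y _ => optValue_le_candidateValue m y
  have hchosen := pow_integral_le_integral_candidateValue m (hmem m).2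
  have hrest := sum_le_integral_pow_mul_optValue hu hmem 0 m
  simp only [zero_add, pow_zero, one_mul, CharP.cast_eq_zero, Finset.sum_add_distrib] at hrest
  rw [optValue_succ, zero_mul, zero_add, Finset.sum_range_succ, Nat.sub_self, pow_zero, one_mul]
  linarith

end LowerBound

section RiemannSum

lemma abs_riemannSum_sub_integral_le {f : ℝ → ℝ} (hf : ContinuousOn f (Set.Icc 0 1)) {ε : ℝ} {m : ℕ}
    (hm : 0 < m) (hε : ∀ x ∈ Set.Icc (0 : ℝ) 1, ∀ y ∈ Set.Icc (0 : ℝ) 1, |x - y| ≤ 1 / m →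
      |f x - f y| ≤ ε) :
    |(∑ k ∈ Finset.range m, f ((k + 1) / m)) / m - ∫ x in (0 : ℝ)..1, f x| ≤ ε := by
  have hm' : (0 : ℝ) < m := Nat.cast_pos.2 hm
  have hpiece (k : ℕ) (hk : k < m) :
      Set.Icc ((k : ℝ) / m) ((k + 1 : ℕ) / m) ⊆ Set.Icc 0 1 :=
    Set.Icc_subset_Icc (by positivity) ((div_le_one hm').2 (by exact_mod_cast hk))
  have hle (k : ℕ) : (k : ℝ) / m ≤ (k + 1 : ℕ) / m := by gcongr; simp
  have hwidth (k : ℕ) : ((k + 1 : ℕ) : ℝ) / m - k / m = 1 / m := by push_cast; ring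
  have hint (k : ℕ) (hk : k < m) :
      IntervalIntegrable f volume ((k : ℝ) / m) ((k + 1 : ℕ) / m) :=
    (hf.mono (hpiece k hk)).intervalIntegrable_of_Icc (hle k)
  have herror : ∀ k ∈ Finset.range m,
      |f ((k + 1) / m) / m - ∫ x in (k : ℝ) / m..(k + 1 : ℕ) / m, f x| ≤ ε / m := fun k hk => by
    have hk := Finset.mem_range.1 hk
    have hconst : f ((k + 1) / m) / m =
        ∫ _ in (k : ℝ) / m..(k + 1 : ℕ) / m, f ((k + 1 : ℕ) / m) := by
      rw [intervalIntegral.integral_const, hwidth, smul_eq_mul]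
      push_cast
      ring
    rw [hconst, ← intervalIntegral.integral_sub intervalIntegrable_const (hint k hk),
      ← Real.norm_eq_abs]
    refine (intervalIntegral.norm_integral_le_of_norm_le_const fun x hx => ?_).trans_eq
      (b := ε * |((k + 1 : ℕ) : ℝ) / m - k / m|) ?_
    · rw [Set.uIoc_of_le (hle k)] at hx
      refine hε _ (hpiece k hk ⟨hle k, le_rfl⟩) _ (hpiece k hk ⟨hx.1.le, hx.2⟩) ?_
      rw [abs_of_nonneg (sub_nonneg.2 hx.2)]
      linarith [hwidth k, hx.1]
    · rw [hwidth, abs_of_pos (by positivity), mul_one_div]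
  have hsum := intervalIntegral.sum_integral_adjacent_intervals (a := fun k : ℕ => (k : ℝ) / m) hint
  rw [Nat.cast_zero, zero_div, div_self hm'.ne'] at hsum
  rw [← hsum, Finset.sum_div, ← Finset.sum_sub_distrib]
  calc _ ≤ ∑ _k ∈ Finset.range m, ε / m :=
        (Finset.abs_sum_le_sum_abs _ _).trans (Finset.sum_le_sum herror)
    _ = ε := by rw [Finset.sum_const, Finset.card_range, nsmul_eq_mul, mul_div_cancel₀ _ hm'.ne']

lemma tendsto_riemannSum {f : ℝ → ℝ} (hf : ContinuousOn f (Set.Icc 0 1)) :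
    Tendsto (fun m : ℕ => (∑ k ∈ Finset.range m, f ((k + 1) / m)) / m) atTop
      (𝓝 (∫ x in (0 : ℝ)..1, f x)) := by
  refine Metric.tendsto_atTop'.2 fun ε hε => ?_
  obtain ⟨δ, hδ, hfδ⟩ := Metric.uniformContinuousOn_iff_le.1
    (isCompact_Icc.uniformContinuousOn_of_continuous hf) (ε / 2) (half_pos hε)
  obtain ⟨N, hN⟩ := exists_nat_one_div_lt hδ
  refine ⟨N, fun m hm => ?_⟩
  have hmesh : 1 / (m : ℝ) ≤ δ :=
    (one_div_le_one_div_of_le (by positivity) (by exact_mod_cast hm)).trans hN.le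
  exact (abs_riemannSum_sub_integral_le hf (N.zero_le.trans_lt hm)
    fun x hx y hy hxy => hfδ x hx y hy (hxy.trans hmesh)).trans_lt (half_lt_self hε)

end RiemannSum

section ExponentialIntegral

lemma continuous_inv_mul_expNegInvGlue : Continuous fun x : ℝ => x⁻¹ * expNegInvGlue x := by
  simpa using expNegInvGlue.continuous_polynomial_eval_inv_mul Polynomial.X

lemma tendsto_sum_exp_div {c : ℝ} (hc : 0 < c) :
    Tendsto (fun m : ℕ => ∑ k ∈ Finset.range m, Real.exp (-(c * m / (k + 1))) / (k + 1)) atTop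
      (𝓝 (∫ x in (0 : ℝ)..c⁻¹, x⁻¹ * expNegInvGlue x)) := by
  have hsubst : ∫ x in (0 : ℝ)..c⁻¹, x⁻¹ * expNegInvGlue x =
      ∫ x in (0 : ℝ)..1, c⁻¹ * ((x / c)⁻¹ * expNegInvGlue (x / c)) := by
    rw [intervalIntegral.integral_const_mul,
      intervalIntegral.inv_mul_integral_comp_div (f := fun x => x⁻¹ * expNegInvGlue x) c, zero_div,
      one_div]
  have hcont : Continuous fun x => c⁻¹ * ((x / c)⁻¹ * expNegInvGlue (x / c)) :=
    (continuous_inv_mul_expNegInvGlue.comp (continuous_id.div_const c)).const_mul c⁻¹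
  rw [hsubst]
  refine (tendsto_riemannSum hcont.continuousOn).congr fun m => ?_
  rw [Finset.sum_div]
  refine Finset.sum_congr rfl fun k hk => ?_
  have hm : (0 : ℝ) < m := Nat.cast_pos.2 (Nat.zero_lt_of_lt (Finset.mem_range.1 hk))
  rw [expNegInvGlue, if_neg (not_le.2 (by positivity)),
    show (((k : ℝ) + 1) / m / c)⁻¹ = c * m / (k + 1) by field_simp]
  field_simp

lemma expNegInvGlue_mul_le_integral {R R' : ℝ → ℝ} {x : ℝ} (hx : 0 ≤ x)
    (hR : ∀ y ∈ Set.Icc 0 x, HasDerivAt R (R' y) y)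
    (hle : ∀ y ∈ Set.Ioo 0 x, R y + y ^ 2 * R' y ≤ y) :
    expNegInvGlue x * R x ≤ ∫ y in (0 : ℝ)..x, y⁻¹ * expNegInvGlue y := by
  have hglue (y : ℝ) : HasDerivAt expNegInvGlue (y⁻¹ ^ 2 * expNegInvGlue y) y := by
    simpa using expNegInvGlue.hasDerivAt_polynomial_eval_inv_mul 1 y
  have hderiv : ∀ y ∈ Set.Icc 0 x, HasDerivAt (fun y => expNegInvGlue y * R y)
      (y⁻¹ ^ 2 * expNegInvGlue y * R y + expNegInvGlue y * R' y) y :=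
    fun y hy => (hglue y).mul (hR y hy)
  have hftc := intervalIntegral.sub_le_integral_of_hasDeriv_right_of_le hx
    (fun y hy => (hderiv y hy).continuousAt.continuousWithinAt)
    (fun y hy => (hderiv y ⟨hy.1.le, hy.2.le⟩).hasDerivWithinAt)
    continuous_inv_mul_expNegInvGlue.continuousOn.integrableOn_Icc fun y hy => by
      have hy0 : 0 < y := hy.1
      calc y⁻¹ ^ 2 * expNegInvGlue y * R y + expNegInvGlue y * R' y
          = y⁻¹ ^ 2 * expNegInvGlue y * (R y + y ^ 2 * R' y) := by field_simp
        _ ≤ y⁻¹ ^ 2 * expNegInvGlue y * y := by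
          have := expNegInvGlue.nonneg y
          gcongr
          exact hle y hy
        _ = y⁻¹ * expNegInvGlue y := by field_simp
  simpa using hftc

/-- With `t = 1 / x`, the integral is the exponential integral `E₁ t`, and the fraction is
`1 / (t + 1 - 1 / (t + 3 - 4 / (t + 5 - (11 / 2) / (t + 5 / 2))))`. Its last level replaces the tail
`9 / (t + 7 - ⋯)` of the continued fraction of `exp t * E₁ t`, which converges too slowly. -/
lemma expNegInvGlue_mul_div_le_integral {x : ℝ} (hx : 0 ≤ x) :
    expNegInvGlue x * ((2 * x + 21 * x ^ 2 + 51 * x ^ 3 + 22 * x ^ 4) /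
        (2 + 23 * x + 70 * x ^ 2 + 58 * x ^ 3 + 8 * x ^ 4)) ≤
      ∫ y in (0 : ℝ)..x, y⁻¹ * expNegInvGlue y := by
  have hq {y : ℝ} (hy : 0 ≤ y) : 0 < 2 + 23 * y + 70 * y ^ 2 + 58 * y ^ 3 + 8 * y ^ 4 := by
    positivity
  have hnum (y : ℝ) : HasDerivAt (fun y => 2 * y + 21 * y ^ 2 + 51 * y ^ 3 + 22 * y ^ 4)
      (2 + 42 * y + 153 * y ^ 2 + 88 * y ^ 3) y := by
    refine HasDerivAt.congr_deriv ((((hasDerivAt_id' y).const_mul 2).add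
      ((hasDerivAt_pow 2 y).const_mul 21)).add ((hasDerivAt_pow 3 y).const_mul 51) |>.add
      ((hasDerivAt_pow 4 y).const_mul 22)) ?_
    norm_num
    ring
  have hden (y : ℝ) : HasDerivAt (fun y => 2 + 23 * y + 70 * y ^ 2 + 58 * y ^ 3 + 8 * y ^ 4)
      (23 + 140 * y + 174 * y ^ 2 + 32 * y ^ 3) y := by
    refine HasDerivAt.congr_deriv (((((hasDerivAt_id' y).const_mul 23).const_add 2).add
      ((hasDerivAt_pow 2 y).const_mul 70)).add ((hasDerivAt_pow 3 y).const_mul 58) |>.add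
      ((hasDerivAt_pow 4 y).const_mul 8)) ?_
    norm_num
    ring
  refine expNegInvGlue_mul_le_integral hx
    (fun y hy => (hnum y).div (hden y) (hq hy.1).ne') fun y hy => ?_
  have hy0 : 0 < y := hy.1
  have := hq hy0.le
  rw [← sub_nonneg]
  have hdefect : 0 ≤ 4 * y ^ 7 * (14 - 29 * y + 16 * y ^ 2) := by
    have : 0 ≤ 14 - 29 * y + 16 * y ^ 2 := by nlinarith [sq_nonneg (32 * y - 29)]
    positivity
  refine (div_nonneg hdefect (sq_nonneg _)).trans_eq (b := 4 * y ^ 7 * (14 - 29 * y + 16 * y ^ 2) /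
    (2 + 23 * y + 70 * y ^ 2 + 58 * y ^ 3 + 8 * y ^ 4) ^ 2) ?_
  rw [Pi.div_apply]
  field_simp
  ring

end ExponentialIntegral

section Asymptotics

variable {c : ℝ}

lemma pow_exp_neg_div (c : ℝ) (i k : ℕ) :
    Real.exp (-(c / (i + 1))) ^ k = Real.exp (-(c * k / (i + 1))) := by
  rw [← Real.exp_nat_mul]
  ring_nf

lemma pow_succ_exp_neg_div (c : ℝ) (i : ℕ) :
    Real.exp (-(c / (i + 1))) ^ (i + 1) = Real.exp (-c) := by
  have : (i : ℝ) + 1 ≠ 0 := by positivity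
  rw [pow_exp_neg_div, Nat.cast_succ, mul_div_cancel_right₀ c this]

lemma pow_sub_exp_neg_div (c : ℝ) {i m : ℕ} (hi : i ≤ m) :
    Real.exp (-(c / (i + 1))) ^ (m - i) =
      Real.exp c * Real.exp (-(c * (m + 1 : ℕ) / (i + 1))) := by
  rw [pow_exp_neg_div, ← Real.exp_add, Nat.cast_sub hi]
  have : (i : ℝ) + 1 ≠ 0 := by positivity
  congr 1
  push_cast
  linear_combination c * mul_inv_cancel₀ this

lemma monotone_exp_neg_div (hc : 0 ≤ c) : Monotone fun i : ℕ => Real.exp (-(c / (i + 1))) :=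
  fun i j hij => by
    dsimp only
    gcongr

lemma exp_neg_div_mem_Icc (hc : 0 ≤ c) (i : ℕ) :
    Real.exp (-(c / (i + 1))) ∈ Set.Icc (0 : ℝ) 1 :=
  ⟨(Real.exp_pos _).le, Real.exp_le_one_iff.2 (neg_nonpos.2 (by positivity))⟩

lemma exp_neg_mul_sum_div_le (hc : 0 ≤ c) {i r : ℕ} (hi : i < r) (n : ℕ) :
    Real.exp (-c) * ((∑ p ∈ Finset.range n, c ^ (p + 1) / (p + 1).factorial *
        (((i : ℝ) + 1) / (r + 1)) ^ p) / (r + 1)) ≤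
      (Real.exp (-(c / (r + 1))) ^ (r - 1 - i) - Real.exp (-(c / (r + 1))) ^ r) / (i + 1) := by
  set v := Real.exp (-(c / (r + 1))) with hv
  have : 0 < v := Real.exp_pos _
  set x := c * ((i + 1) / (r + 1)) with hx
  have hseries : (∑ p ∈ Finset.range n, x ^ (p + 1) / (p + 1).factorial) ≤ Real.exp x - 1 := by
    have h := Real.sum_le_exp_of_nonneg (x := x) (by positivity) (n + 1)
    rw [Finset.sum_range_succ', pow_zero, Nat.factorial_zero, Nat.cast_one, div_one] at h
    linarith
  have hsplit : v ^ (r - 1 - i) = v ^ r * Real.exp x := by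
    have hinv : v ^ (i + 1) * Real.exp x = 1 := by
      rw [hv, pow_exp_neg_div, ← Real.exp_add, Real.exp_eq_one_iff, hx]
      push_cast
      ring
    rw [← mul_one (v ^ (r - 1 - i)), ← hinv, ← mul_assoc, ← pow_add,
      show r - 1 - i + (i + 1) = r by lia]
  have hexp : Real.exp (-c) ≤ v ^ r := by
    rw [← pow_succ_exp_neg_div c r, pow_succ]
    exact mul_le_of_le_one_right (by positivity) (exp_neg_div_mem_Icc hc r).2
  rw [le_div_iff₀ (by positivity), hsplit]
  calc _ = Real.exp (-c) * ∑ p ∈ Finset.range n, x ^ (p + 1) / (p + 1).factorial := by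
        rw [mul_assoc, div_mul_eq_mul_div, Finset.sum_mul, Finset.sum_div]
        congr 1
        refine Finset.sum_congr rfl fun p _ => ?_
        rw [hx, mul_pow]
        ring
    _ ≤ v ^ r * (Real.exp x - 1) :=
        mul_le_mul hexp hseries (Finset.sum_nonneg fun p _ => by positivity) (by positivity)
    _ = v ^ r * Real.exp x - v ^ r := by ring

/-- The waiting value at `exp (-c / (r + 1))` tends to
`exp (-c) * ∫ u in 0..1, (exp (c * u) - 1) / u`, where the integral is expanded into a power series
in `c`. -/
lemma eventually_le_optValue_exp (hc : 0 ≤ c) (n : ℕ) {κ : ℝ}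
    (hκ : κ < Real.exp (-c) *
      ∑ p ∈ Finset.range n, c ^ (p + 1) / ((p + 1).factorial * (p + 1))) :
    ∀ᶠ r : ℕ in atTop, κ ≤ optValue r (Real.exp (-(c / (r + 1)))) := by
  set g : ℝ → ℝ := fun x => ∑ p ∈ Finset.range n, c ^ (p + 1) / (p + 1).factorial * x ^ p with hg
  have hint : ∫ x in (0 : ℝ)..1, g x =
      ∑ p ∈ Finset.range n, c ^ (p + 1) / ((p + 1).factorial * (p + 1)) := by
    rw [intervalIntegral.integral_finsetSum
      fun p _ => Continuous.intervalIntegrable (by fun_prop) _ _]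
    simp only [intervalIntegral.integral_const_mul, integral_pow, one_pow,
      zero_pow (Nat.succ_ne_zero _), sub_zero, div_mul_div_comm, mul_one]
  have hlim : Tendsto (fun r : ℕ => Real.exp (-c) *
      ((∑ k ∈ Finset.range (r + 1), g ((k + 1) / (r + 1 : ℕ))) / (r + 1 : ℕ) - g 1 / (r + 1 : ℕ)))
      atTop (𝓝 (Real.exp (-c) * ((∫ x in (0 : ℝ)..1, g x) - 0))) :=
    (((tendsto_riemannSum (f := g) (by fun_prop)).comp (tendsto_add_atTop_nat 1)).sub
      ((tendsto_const_div_atTop_nhds_zero_nat (g 1)).comp (tendsto_add_atTop_nat 1))).const_mul _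
  rw [sub_zero, hint] at hlim
  filter_upwards [hlim.eventually_const_le hκ] with r hr
  refine hr.trans (le_trans ?_ (sum_le_optValue r (exp_neg_div_mem_Icc hc r)))
  have hlast : ((r : ℝ) + 1) / (r + 1 : ℕ) = 1 := by push_cast; exact div_self (by positivity)
  rw [Finset.sum_range_succ, hlast, ← sub_div, add_sub_cancel_right, Finset.sum_div, Finset.mul_sum]
  refine Finset.sum_le_sum fun i hi => ?_
  simpa only [hg, Nat.cast_succ] using exp_neg_mul_sum_div_le hc (Finset.mem_range.1 hi) n

lemma sum_mul_one_sub_pow_exp (c : ℝ) (m : ℕ) :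
    ∑ i ∈ Finset.range (m + 1), Real.exp (-(c / (i + 1))) ^ (m - i) *
        ((1 - Real.exp (-(c / (i + 1))) ^ (i + 1)) / (i + 1)) =
      (Real.exp c - 1) *
        ∑ i ∈ Finset.range (m + 1), Real.exp (-(c * (m + 1 : ℕ) / (i + 1))) / (i + 1) := by
  rw [Finset.mul_sum]
  refine Finset.sum_congr rfl fun i hi => ?_
  rw [pow_succ_exp_neg_div, pow_sub_exp_neg_div c (Finset.mem_range_succ_iff.1 hi)]
  have : Real.exp c * Real.exp (-c) = 1 := by rw [← Real.exp_add, add_neg_cancel, Real.exp_zero]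
  linear_combination (-Real.exp (-(c * (m + 1 : ℕ) / (i + 1))) / (i + 1)) * this

lemma le_sum_Ico_sub_pow_exp (hc : 0 ≤ c) {R m : ℕ} (hR : R ≤ m) :
    1 - Real.exp (-(c / (R + 1))) ^ (m - R) - c * Real.exp c *
        ∑ i ∈ Finset.range (m + 1), Real.exp (-(c * (m + 1 : ℕ) / (i + 1))) / (i + 1) ≤
      ∑ i ∈ Finset.Ico R m, (Real.exp (-(c / ((i + 1 : ℕ) + 1))) ^ (m - i) -
        Real.exp (-(c / (i + 1))) ^ (m - i)) := by
  set u : ℕ → ℝ := fun i => Real.exp (-(c / (i + 1))) with hu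
  set e : ℕ → ℝ := fun i => Real.exp (-(c * (m + 1 : ℕ) / (i + 1))) / (i + 1) with he
  have hterm : ∀ i ∈ Finset.Ico R m, (u (i + 1) ^ (m - (i + 1)) - u i ^ (m - i)) -
      c * Real.exp c * e (i + 1) ≤ u (i + 1) ^ (m - i) - u i ^ (m - i) := fun i hi => by
    have him := (Finset.mem_Ico.1 hi).2
    have hsub : 1 - c / ((i + 1 : ℕ) + 1) ≤ u (i + 1) := by
      linarith [Real.add_one_le_exp (-(c / ((i + 1 : ℕ) + 1)))]
    have hpow : u (i + 1) ^ (m - (i + 1)) * (c / ((i + 1 : ℕ) + 1)) =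
        c * Real.exp c * e (i + 1) := by
      simp only [hu, he]
      rw [pow_sub_exp_neg_div c him]
      ring
    rw [show m - i = m - (i + 1) + 1 by lia, pow_succ (u (i + 1)), ← hpow]
    have : 0 ≤ u (i + 1) ^ (m - (i + 1)) := pow_nonneg (exp_neg_div_mem_Icc hc _).1 _
    nlinarith [mul_le_mul_of_nonneg_left hsub this]
  have htail : ∑ i ∈ Finset.Ico R m, e (i + 1) ≤ ∑ i ∈ Finset.range (m + 1), e i := by
    rw [Finset.sum_Ico_add' e R m 1]
    exact Finset.sum_le_sum_of_subset_of_nonneg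
      (fun i hi => Finset.mem_range.2 (Finset.mem_Ico.1 hi).2) fun i _ _ => by positivity
  calc 1 - u R ^ (m - R) - c * Real.exp c * ∑ i ∈ Finset.range (m + 1), e i
      ≤ (u m ^ (m - m) - u R ^ (m - R)) - c * Real.exp c * ∑ i ∈ Finset.Ico R m, e (i + 1) := by
        rw [Nat.sub_self, pow_zero]
        gcongr
    _ = ∑ i ∈ Finset.Ico R m, ((u (i + 1) ^ (m - (i + 1)) - u i ^ (m - i)) -
          c * Real.exp c * e (i + 1)) := by
        rw [Finset.sum_sub_distrib, Finset.sum_Ico_sub (fun i => u i ^ (m - i)) hR, Finset.mul_sum]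
    _ ≤ _ := Finset.sum_le_sum hterm

/-- The accepting and the waiting parts of `sum_add_sum_le_optValue` at `u i = exp (-c / (i + 1))`,
whose `(i + 1)`-st power is constant. -/
lemma eventually_le_optValue_zero (hc : 0 < c) {κ L : ℝ} (hκ : 0 ≤ κ)
    (hwait : ∀ᶠ r : ℕ in atTop, κ ≤ optValue r (Real.exp (-(c / (r + 1)))))
    (hL : L < (Real.exp c - 1 - κ * (c * Real.exp c)) *
      (∫ x in (0 : ℝ)..c⁻¹, x⁻¹ * expNegInvGlue x) + κ) :
    ∀ᶠ m : ℕ in atTop, L ≤ optValue m 0 := by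
  obtain ⟨R, hR⟩ := eventually_atTop.1 hwait
  set S : ℕ → ℝ := fun m => ∑ i ∈ Finset.range m, Real.exp (-(c * m / (i + 1))) / (i + 1)
  have hpow : Tendsto (fun m : ℕ => Real.exp (-(c / (R + 1))) ^ (m - R)) atTop (𝓝 0) :=
    (tendsto_pow_atTop_nhds_zero_of_lt_one (Real.exp_pos _).le
      (Real.exp_lt_one_iff.2 (neg_neg_of_pos (by positivity)))).comp (tendsto_sub_atTop_nat R)
  have hlim : Tendsto (fun m : ℕ => (Real.exp c - 1) * S (m + 1) +
      κ * (1 - Real.exp (-(c / (R + 1))) ^ (m - R) - c * Real.exp c * S (m + 1))) atTop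
      (𝓝 ((Real.exp c - 1) * (∫ x in (0 : ℝ)..c⁻¹, x⁻¹ * expNegInvGlue x) +
        κ * (1 - 0 - c * Real.exp c * ∫ x in (0 : ℝ)..c⁻¹, x⁻¹ * expNegInvGlue x))) := by
    have hsum := (tendsto_sum_exp_div hc).comp (tendsto_add_atTop_nat 1)
    exact (hsum.const_mul _).add (((hpow.const_sub 1).sub (hsum.const_mul _)).const_mul κ)
  rw [← map_add_atTop_eq_nat 1, eventually_map]
  filter_upwards [hlim.eventually_const_le (hL.trans_eq (by ring)), eventually_ge_atTop R]
    with m hm hRm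
  refine hm.trans (le_trans ?_ (sum_add_sum_le_optValue (monotone_exp_neg_div hc.le)
    (exp_neg_div_mem_Icc hc.le) m))
  rw [sum_mul_one_sub_pow_exp]
  refine add_le_add_right ?_ _
  have hnonneg (i : ℕ) : 0 ≤ Real.exp (-(c / ((i + 1 : ℕ) + 1))) ^ (m - i) -
      Real.exp (-(c / (i + 1))) ^ (m - i) :=
    sub_nonneg.2 (pow_le_pow_left₀ (Real.exp_pos _).le
      (monotone_exp_neg_div hc.le i.le_succ) _)
  calc _ ≤ κ * ∑ i ∈ Finset.Ico R m, (Real.exp (-(c / ((i + 1 : ℕ) + 1))) ^ (m - i) -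
          Real.exp (-(c / (i + 1))) ^ (m - i)) :=
        mul_le_mul_of_nonneg_left (le_sum_Ico_sub_pow_exp hc.le hRm) hκ
    _ ≤ ∑ i ∈ Finset.Ico R m, (Real.exp (-(c / ((i + 1 : ℕ) + 1))) ^ (m - i) -
          Real.exp (-(c / (i + 1))) ^ (m - i)) *
          optValue (i + 1) (Real.exp (-(c / ((i + 1 : ℕ) + 1)))) := by
        rw [Finset.mul_sum]
        refine Finset.sum_le_sum fun i hi => ?_
        rw [mul_comm κ]
        exact mul_le_mul_of_nonneg_left (hR _ (Finset.mem_Ico.1 hi).1.step) (hnonneg i)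
    _ ≤ _ := Finset.sum_le_sum_of_subset_of_nonneg
        (fun i hi => Finset.mem_range.2 (Finset.mem_Ico.1 hi).2)
        fun i _ _ => mul_nonneg (hnonneg i) (optValue_nonneg _ (exp_neg_div_mem_Icc hc.le _))

lemma exp_neg_four_fifths_mem_Icc :
    Real.exp (-(4 / 5)) ∈ Set.Icc (0.449328 : ℝ) 0.44933 := by
  have h := abs_le.1 (Real.exp_bound (x := -(4 / 5)) (by norm_num [abs_of_pos]) (n := 9)
    (by norm_num))
  norm_num [Finset.sum_range_succ, Nat.factorial, abs_of_pos] at h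
  constructor <;> linarith

/-- The optimal threshold with `r` values to come is asymptotically `1 - 0.8043… / r`, whence the
parameter `4 / 5`. -/
lemma eventually_gilbertMosteller_le_optValue :
    ∀ᶠ m : ℕ in atTop, 0.5801 ≤ optValue m 0 := by
  obtain ⟨hlow, hupp⟩ := exp_neg_four_fifths_mem_Icc
  refine eventually_le_optValue_zero (c := 4 / 5) (κ := 0.44629) (by norm_num) (by norm_num)
    (eventually_le_optValue_exp (by norm_num) 5 ?_) ?_
  · norm_num [Finset.sum_range_succ, Nat.factorial]
    linarith
  · have hmul : Real.exp (4 / 5) * Real.exp (-(4 / 5)) = 1 := by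
      rw [← Real.exp_add, add_neg_cancel, Real.exp_zero]
    have hint : 0.69112 * Real.exp (-(4 / 5)) ≤
        ∫ x in (0 : ℝ)..(4 / 5)⁻¹, x⁻¹ * expNegInvGlue x := by
      refine le_trans ?_ (expNegInvGlue_mul_div_le_integral (by norm_num))
      rw [expNegInvGlue, if_neg (by norm_num), inv_inv, mul_comm]
      gcongr
      norm_num
    have hcoeff : 0 ≤ Real.exp (4 / 5) - 1 - 0.44629 * (4 / 5 * Real.exp (4 / 5)) := by
      linarith [Real.add_one_le_exp (4 / 5 : ℝ)]
    calc (0.5801 : ℝ) < (Real.exp (4 / 5) - 1 - 0.44629 * (4 / 5 * Real.exp (4 / 5))) *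
          (0.69112 * Real.exp (-(4 / 5))) + 0.44629 := by nlinarith
      _ ≤ _ := by gcongr

end Asymptotics

section Cdf

variable (μ : Measure ℝ)

lemma cdf_mem_Icc (x : ℝ) : cdf μ x ∈ Set.Icc (0 : ℝ) 1 :=
  ⟨cdf_nonneg μ x, cdf_le_one μ x⟩

variable [IsProbabilityMeasure μ] [NullSingletonClass μ]

lemma continuous_cdf : Continuous (cdf μ) := by
  refine continuous_iff_continuousAt.2 fun x => ?_
  rw [(monotone_cdf μ).continuousAt_iff_leftLim_eq_rightLim, StieltjesFunction.rightLim_eq]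
  have hjump := (cdf μ).measure_singleton x
  rw [measure_cdf, measure_singleton, eq_comm, ENNReal.ofReal_eq_zero] at hjump
  exact le_antisymm ((monotone_cdf μ).leftLim_le le_rfl) (by linarith)

lemma measureReal_Iio_eq_cdf (x : ℝ) : μ.real (Set.Iio x) = cdf μ x := by
  rw [cdf_eq_real]
  exact measureReal_congr Iio_ae_eq_Iic

lemma measureReal_Ici_eq_cdf (x : ℝ) : μ.real (Set.Ici x) = 1 - cdf μ x := by
  rw [← Set.compl_Iio, probReal_compl_eq_one_sub measurableSet_Iio, measureReal_Iio_eq_cdf]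

lemma exists_cdf_eq {a : ℝ} (ha : a ∈ Set.Ioo (0 : ℝ) 1) : ∃ x, cdf μ x = a := by
  obtain ⟨y, hy⟩ := ((tendsto_cdf_atBot μ).eventually (gt_mem_nhds ha.1)).exists
  obtain ⟨z, hz⟩ := ((tendsto_cdf_atTop μ).eventually (lt_mem_nhds ha.2)).exists
  exact mem_range_of_exists_le_of_exists_ge (continuous_cdf μ) ⟨y, hy.le⟩ ⟨z, hz.le⟩

lemma measureReal_cdf_le {a : ℝ} (ha : a ∈ Set.Ico (0 : ℝ) 1) : μ.real {x | cdf μ x ≤ a} = a := by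
  have hpos (h : 0 < a) : ∃ x, cdf μ x = a := exists_cdf_eq μ ⟨h, ha.2⟩
  rcases Set.eq_empty_or_nonempty {x | cdf μ x ≤ a} with hempty | hne
  · have : a ≤ 0 := le_of_not_gt fun h => by
      obtain ⟨x, hx⟩ := hpos h
      exact hempty.subset hx.le
    rw [hempty, measureReal_empty, le_antisymm this ha.1]
  obtain ⟨z, hz⟩ := ((tendsto_cdf_atTop μ).eventually (lt_mem_nhds ha.2)).exists
  have hbdd : BddAbove {x | cdf μ x ≤ a} :=
    ⟨z, fun x hx => le_of_not_gt fun hzx => (hz.trans_le (monotone_cdf μ hzx.le)).not_ge hx⟩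
  have hmem : cdf μ (sSup {x | cdf μ x ≤ a}) ≤ a :=
    (isClosed_le (continuous_cdf μ) continuous_const).csSup_mem hne hbdd
  have hset : {x | cdf μ x ≤ a} = Set.Iic (sSup {x | cdf μ x ≤ a}) :=
    Set.Subset.antisymm (fun x hx => le_csSup hbdd hx) fun x hx => (monotone_cdf μ hx).trans hmem
  rw [hset, ← cdf_eq_real]
  refine le_antisymm hmem ?_
  rcases ha.1.eq_or_lt with rfl | h
  · exact cdf_nonneg μ _
  · obtain ⟨x, hx⟩ := hpos h
    exact hx.ge.trans (monotone_cdf μ (le_csSup hbdd hx.le))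

lemma map_cdf_eq_volume_restrict : μ.map (cdf μ) = volume.restrict (Set.Icc 0 1) := by
  have hmeas : Measurable (cdf μ) := (continuous_cdf μ).measurable
  refine Measure.ext_of_Iic _ _ fun a => ?_
  rw [Measure.map_apply hmeas measurableSet_Iic, Measure.restrict_apply measurableSet_Iic]
  rcases lt_or_ge a 0 with ha | ha
  · have hcdf : cdf μ ⁻¹' Set.Iic a = ∅ :=
      Set.eq_empty_of_forall_notMem fun x => (ha.trans_le (cdf_nonneg μ x)).not_ge
    have hIcc : Set.Iic a ∩ Set.Icc 0 1 = ∅ :=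
      Set.eq_empty_of_forall_notMem fun x hx => (ha.trans_le hx.2.1).not_ge hx.1
    simp only [hcdf, hIcc, measure_empty]
  rcases lt_or_ge a 1 with ha1 | ha1
  · have hIcc : Set.Iic a ∩ Set.Icc 0 1 = Set.Icc 0 a := by
      rw [Set.inter_comm, ← Set.Ici_inter_Iic, Set.inter_assoc, Set.Iic_inter_Iic,
        inf_eq_right.2 ha1.le, Set.Ici_inter_Iic]
    rw [hIcc, Real.volume_Icc, sub_zero, ← ofReal_measureReal]
    exact congrArg _ (measureReal_cdf_le μ ⟨ha, ha1⟩)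
  · have hcdf : cdf μ ⁻¹' Set.Iic a = Set.univ :=
      Set.eq_univ_of_forall fun x => (cdf_le_one μ x).trans ha1
    have hIcc : Set.Iic a ∩ Set.Icc 0 1 = Set.Icc 0 1 :=
      Set.inter_eq_right.2 fun x hx => hx.2.trans ha1
    simp [hcdf, hIcc]

lemma integrable_comp_cdf {φ : ℝ → ℝ} (hφ : Continuous φ) :
    Integrable (fun x => φ (cdf μ x)) μ := by
  refine Integrable.comp_measurable (f := cdf μ) ?_ (continuous_cdf μ).measurable
  rw [map_cdf_eq_volume_restrict]
  exact hφ.integrableOn_Icc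

lemma setIntegral_comp_cdf {φ : ℝ → ℝ} (hφ : Measurable φ) (t : ℝ) :
    ∫ x in Set.Ici t, φ (cdf μ x) ∂μ = ∫ u in (cdf μ t)..1, φ u := by
  have hmeas : Measurable (cdf μ) := (continuous_cdf μ).measurable
  have hsub : Set.Ici t ⊆ cdf μ ⁻¹' Set.Ici (cdf μ t) := fun x hx => monotone_cdf μ hx
  have hIcc : Set.Ici (cdf μ t) ∩ Set.Icc 0 1 = Set.Icc (cdf μ t) 1 := by
    rw [Set.inter_comm, ← Set.Ici_inter_Iic, Set.inter_right_comm, Set.Ici_inter_Ici,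
      sup_eq_right.2 (cdf_nonneg μ t), Set.Ici_inter_Iic]
  have hae : Set.Ici t =ᵐ[μ] cdf μ ⁻¹' Set.Ici (cdf μ t) := by
    refine ae_eq_of_subset_of_measure_ge hsub ?_ measurableSet_Ici.nullMeasurableSet
      (measure_ne_top _ _)
    rw [← Measure.map_apply hmeas measurableSet_Ici, map_cdf_eq_volume_restrict,
      Measure.restrict_apply measurableSet_Ici, hIcc, Real.volume_Icc, ← measureReal_Ici_eq_cdf,
      ofReal_measureReal]
  rw [setIntegral_congr_set hae, ← setIntegral_map measurableSet_Ici hφ.aestronglyMeasurable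
    hmeas.aemeasurable, map_cdf_eq_volume_restrict, Measure.restrict_restrict measurableSet_Ici,
    hIcc, integral_Icc_eq_integral_Ioc, intervalIntegral.integral_of_le (cdf_le_one μ t)]

end Cdf

section Pi

lemma measureReal_pi_forall_le {ι : Type*} [Fintype ι] (D : ι → Measure ℝ)
    [∀ i, IsProbabilityMeasure (D i)] (y : ℝ) :
    (Measure.pi D).real {x | ∀ i, x i ≤ y} = ∏ i, cdf (D i) y := by
  have hset : {x : ι → ℝ | ∀ i, x i ≤ y} = Set.univ.pi fun _ => Set.Iic y := by
    ext x
    simp [Pi.le_def]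
  simp only [hset, measureReal_def, Measure.pi_pi, ENNReal.toReal_prod, cdf_eq_real]

variable {n : ℕ} {α : Fin (n + 1) → Type*} [∀ i, MeasurableSpace (α i)]
  (D : ∀ i, Measure (α i)) (i : Fin (n + 1))

lemma integral_pi_eq_integral_insertNth [∀ i, SigmaFinite (D i)] {E : Type*}
    [NormedAddCommGroup E] [NormedSpace ℝ E] {f : (∀ i, α i) → E}
    (hf : Integrable f (Measure.pi D)) :
    ∫ x, f x ∂Measure.pi D =
      ∫ y, ∫ x, f (i.insertNth y x) ∂Measure.pi (fun j => D (i.succAbove j)) ∂D i := by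
  have hmp := (measurePreserving_piFinSuccAbove D i).symm
  rw [← hmp.integral_comp', integral_prod]
  · rfl
  · exact (hmp.integrable_comp_emb (MeasurableEquiv.measurableEmbedding _)).2 hf

variable [∀ i, IsProbabilityMeasure (D i)]

lemma measureReal_pi_eq_integral {S : Set (∀ i, α i)} (hS : MeasurableSet S) :
    (Measure.pi D).real S = ∫ y, (Measure.pi fun j => D (i.succAbove j)).real
      {x | i.insertNth y x ∈ S} ∂D i := by
  rw [← integral_indicator_one hS, integral_pi_eq_integral_insertNth D i
    ((integrable_const 1).indicator hS)]
  refine integral_congr_ae (Eventually.of_forall fun y => ?_)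
  have hmeas : Measurable fun x : ∀ j, α (i.succAbove j) => (i.insertNth y x : ∀ i, α i) :=
    (MeasurableEquiv.piFinSuccAbove α i).symm.measurable.comp measurable_prodMk_left
  exact integral_indicator_one (hmeas hS)

lemma setIntegral_pi_forall_succAbove_mem {g : α i → ℝ}
    {B : ∀ j : Fin n, α i → Set (α (i.succAbove j))}
    (hB : ∀ j, MeasurableSet {p : α i × α (i.succAbove j) | p.2 ∈ B j p.1})
    (hg : Integrable g (D i)) :
    ∫ x in {x | ∀ j, x (i.succAbove j) ∈ B j (x i)}, g (x i) ∂Measure.pi D =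
      ∫ y, g y * ∏ j, (D (i.succAbove j)).real (B j y) ∂D i := by
  have hS : MeasurableSet {x : ∀ i, α i | ∀ j, x (i.succAbove j) ∈ B j (x i)} := by
    rw [Set.ofPred_forall]
    exact MeasurableSet.iInter fun j =>
      (measurable_pi_apply i).prodMk (measurable_pi_apply (i.succAbove j)) (hB j)
  have hgi : Integrable (fun x => g (x i)) (Measure.pi D) :=
    (measurePreserving_eval D i).integrable_comp_of_integrable hg
  rw [← integral_indicator hS, integral_pi_eq_integral_insertNth D i (hgi.indicator hS)]
  refine integral_congr_ae (Eventually.of_forall fun y => ?_)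
  have hmeas (j : Fin n) : MeasurableSet (B j y) := measurable_prodMk_left (hB j)
  have hind (x : ∀ j, α (i.succAbove j)) :
      ({x : ∀ i, α i | ∀ j, x (i.succAbove j) ∈ B j (x i)}.indicator fun x => g (x i))
        (i.insertNth y x) = (Set.univ.pi fun j => B j y).indicator (fun _ => g y) x := by
    classical
    simp only [Set.indicator_apply, Set.mem_ofPred_eq, Fin.insertNth_apply_same,
      Fin.insertNth_apply_succAbove, Set.mem_univ_pi]
  refine (integral_congr_ae (Eventually.of_forall hind)).trans ?_
  rw [integral_indicator_const _ (MeasurableSet.univ_pi hmeas)]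
  simp only [measureReal_def, Measure.pi_pi, ENNReal.toReal_prod, smul_eq_mul, mul_comm (g y)]

end Pi

lemma ae_injective_pi {n : ℕ} (D : Fin n → Measure ℝ) [∀ i, IsProbabilityMeasure (D i)]
    [∀ i, NullSingletonClass (D i)] : ∀ᵐ x ∂Measure.pi D, Function.Injective x := by
  have hne (i j : Fin n) (hij : i ≠ j) : ∀ᵐ x ∂Measure.pi D, x i ≠ x j := by
    obtain _ | n := n
    · exact i.elim0
    obtain ⟨l, rfl⟩ := Fin.exists_succAbove_eq hij.symm
    have hzero (y : ℝ) : (Measure.pi fun j => D (i.succAbove j)).real {x | y = x l} = 0 := by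
      simp only [eq_comm (a := y), measureReal_def]
      rw [Measure.pi_hyperplane, ENNReal.toReal_zero]
    rw [ae_iff, ← measureReal_eq_zero_iff, measureReal_pi_eq_integral D i]
    · simp [hzero]
    · simpa using measurableSet_eq_fun (measurable_pi_apply i) (measurable_pi_apply (i.succAbove l))
  filter_upwards [ae_all_iff.2 fun i => ae_all_iff.2 fun j => ae_all_iff.2 fun hij => hne i j hij]
    with x hx i j hij
  exact by_contra fun h => hx i j h hij

section RecordUpperBound

variable {m : ℕ}

lemma measurableSet_selectsMax (r : ThresholdRule) (τ : Fin m → ℝ) :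
    MeasurableSet {x | r.SelectsMax τ x} := by
  have hle (i j : Fin m) : Measurable fun x : Fin m → ℝ => x i ≤ x j :=
    measurableSet_setOfPred.1 (measurableSet_le (measurable_pi_apply i) (measurable_pi_apply j))
  have hτ (k : Fin m) : Measurable fun x : Fin m → ℝ => τ k ≤ x k :=
    measurableSet_setOfPred.1 (measurableSet_le measurable_const (measurable_pi_apply k))
  have hacc (k : Fin m) : Measurable fun x => r.Accepts τ x k := by
    cases r with
    | plain => exact hτ k
    | record => exact (hτ k).and (Measurable.forall fun j => measurable_const.imp (hle j k))
  exact measurableSet_setOfPred.2 (Measurable.exists fun k =>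
    ((hacc k).and (Measurable.forall fun j => measurable_const.imp (hacc j).not)).and
      (Measurable.forall fun j => hle j k))

lemma record_selectsMax_cons {σ : Fin (m + 1) → ℝ} {y : ℝ} {x : Fin m → ℝ} :
    ThresholdRule.record.SelectsMax σ (Fin.cons y x : Fin (m + 1) → ℝ) ↔
      (σ 0 ≤ y ∧ ∀ j, x j ≤ y) ∨
        (y < σ 0 ∧ ThresholdRule.record.SelectsMax (fun j => max (σ j.succ) y) x) := by
  simp only [ThresholdRule.SelectsMax, ThresholdRule.StopsAt, ThresholdRule.Accepts,
    Fin.exists_fin_succ, Fin.forall_fin_succ, Fin.cons_zero, Fin.cons_succ, Fin.succ_lt_succ_iff,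
    Fin.not_lt_zero, Fin.succ_pos, max_le_iff]
  grind

variable (μ : Measure ℝ)

lemma iidSuccess_zero (r : ThresholdRule) (σ : Fin 0 → ℝ) : iidSuccess r μ σ = 0 := by
  simp [iidSuccess, ThresholdRule.SelectsMax]

variable [IsProbabilityMeasure μ]

lemma iidSuccess_record_succ (σ : Fin (m + 1) → ℝ) :
    iidSuccess .record μ σ = ∫ y, (if σ 0 ≤ y then cdf μ y ^ m else
      iidSuccess .record μ fun j : Fin m => max (σ j.succ) y) ∂μ := by
  rw [iidSuccess, measureReal_pi_eq_integral (fun _ => μ) 0 (measurableSet_selectsMax _ σ)]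
  refine integral_congr_ae (Eventually.of_forall fun y => ?_)
  simp only [Fin.insertNth_zero', Set.mem_ofPred_eq, record_selectsMax_cons]
  split_ifs with h
  · simp [h, h.not_gt, measureReal_pi_forall_le]
  · simp [h, not_le.1 h, iidSuccess]

lemma iidSuccess_record_le_optValue_cdf [NullSingletonClass μ] (v : ℝ) {σ : Fin m → ℝ}
    (hσ : ∀ k, v ≤ σ k) : iidSuccess .record μ σ ≤ optValue m (cdf μ v) := by
  induction m generalizing v with
  | zero => simp [iidSuccess_zero, optValue]
  | succ m ih =>
    set φ : ℝ → ℝ := (Set.Iio v).piecewise (fun _ => optValue m (cdf μ v))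
      fun y => candidateValue m (cdf μ y)
    have hcand : Integrable (fun y => candidateValue m (cdf μ y)) μ :=
      integrable_comp_cdf μ (continuous_candidateValue m)
    have hφ : Integrable φ μ :=
      Integrable.piecewise measurableSet_Iio (integrable_const _).integrableOn hcand.integrableOn
    rw [iidSuccess_record_succ]
    calc ∫ y, (if σ 0 ≤ y then cdf μ y ^ m else
          iidSuccess .record μ fun j : Fin m => max (σ j.succ) y) ∂μ
        ≤ ∫ y, φ y ∂μ := by
          refine integral_mono_of_nonneg (Eventually.of_forall fun y => ?_) hφ
            (Eventually.of_forall fun y => ?_)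
          · dsimp only [Pi.zero_apply]
            split_ifs
            · exact pow_nonneg (cdf_nonneg μ y) m
            · exact measureReal_nonneg
          rcases lt_or_ge y v with hy | hy
          · simp only [φ, Set.piecewise_eq_of_mem _ _ _ (Set.mem_Iio.2 hy),
              if_neg (hy.trans_le (hσ 0)).not_ge]
            exact ih v fun j => (hσ j.succ).trans (le_max_left _ _)
          · simp only [φ, Set.piecewise_eq_of_notMem _ _ _ (Set.notMem_Iio.2 hy)]
            split_ifs
            · exact pow_le_candidateValue m _
            · exact (ih y fun j => le_max_right _ _).trans (optValue_le_candidateValue m _)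
      _ = optValue (m + 1) (cdf μ v) := by
          rw [integral_piecewise measurableSet_Iio (integrable_const _).integrableOn
            hcand.integrableOn, Set.compl_Iio, setIntegral_const, measureReal_Iio_eq_cdf,
            smul_eq_mul, setIntegral_comp_cdf μ (continuous_candidateValue m).measurable,
            optValue_succ]

lemma iidSuccess_record_le_optValue [NullSingletonClass μ] (σ : Fin m → ℝ) :
    iidSuccess .record μ σ ≤ optValue m 0 := by
  obtain ⟨v, hv⟩ := (Set.finite_range σ).bddBelow
  exact (iidSuccess_record_le_optValue_cdf μ v fun k => hv ⟨k, rfl⟩).trans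
    (antitoneOn_optValue m (by simp) (cdf_mem_Icc μ v) (cdf_nonneg μ v))

end RecordUpperBound

/-- The items `l` have values `x l` and are assigned to blocks `b l`. Item `i` has the largest
value, which is at least `c`, and every item in an earlier block `k` than item `i` lies below `t k`.
With `b = id` and `c = t i`, this is the event that the plain rule with thresholds `t` wins at step
`i`. -/
def slotEvent {n m : ℕ} (b : Fin n → Fin m) (i : Fin n) (c : ℝ) (t : Fin m → ℝ) :
    Set (Fin n → ℝ) :=
  {x | c ≤ x i ∧ (∀ l, x l ≤ x i) ∧ ∀ l, b l < b i → x l < t (b l)}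

section SlotEvent

variable {n m : ℕ} (c : ℝ) (t : Fin m → ℝ)

lemma measurableSet_slotEvent (b : Fin n → Fin m) (i : Fin n) :
    MeasurableSet (slotEvent b i c t) := by
  refine measurableSet_setOfPred.2 ((measurableSet_setOfPred.1 ?_).and
    ((Measurable.forall fun l => measurableSet_setOfPred.1 ?_).and
      (Measurable.forall fun l => measurable_const.imp (measurableSet_setOfPred.1 ?_))))
  · exact measurableSet_le measurable_const (measurable_pi_apply i)
  · exact measurableSet_le (measurable_pi_apply l) (measurable_pi_apply i)
  · exact measurableSet_lt (measurable_pi_apply l) measurable_const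

lemma measureReal_Iio_inter_Iic (μ : Measure ℝ) [IsProbabilityMeasure μ] [NullSingletonClass μ]
    (s v : ℝ) : μ.real (Set.Iio s ∩ Set.Iic v) = cdf μ (min s v) := by
  have hclosed : (Set.Iio s ∩ Set.Iic v : Set ℝ) =ᵐ[μ] (Set.Iic s ∩ Set.Iic v : Set ℝ) :=
    Iio_ae_eq_Iic.inter (ae_eq_refl _)
  rw [measureReal_congr hclosed, Set.Iic_inter_Iic, cdf_eq_real]

lemma measureReal_slotEvent (D : Fin (n + 1) → Measure ℝ) [∀ i, IsProbabilityMeasure (D i)]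
    [∀ i, NullSingletonClass (D i)] (b : Fin (n + 1) → Fin m) (i : Fin (n + 1)) :
    (Measure.pi D).real (slotEvent b i c t) = ∫ v in Set.Ici c, ∏ j, cdf (D (i.succAbove j))
      (if b (i.succAbove j) < b i then min (t (b (i.succAbove j))) v else v) ∂D i := by
  set B : Fin n → ℝ → Set ℝ := fun j v =>
    if b (i.succAbove j) < b i then Set.Iio (t (b (i.succAbove j))) ∩ Set.Iic v else Set.Iic v
  have hBmeas (j : Fin n) : MeasurableSet {p : ℝ × ℝ | p.2 ∈ B j p.1} := by
    have hle : MeasurableSet {p : ℝ × ℝ | p.2 ≤ p.1} :=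
      measurableSet_le measurable_snd measurable_fst
    simp only [B]
    split_ifs
    · exact (measurableSet_lt measurable_snd measurable_const).inter hle
    · exact hle
  have hevent : slotEvent b i c t =
      (fun x => x i) ⁻¹' Set.Ici c ∩ {x | ∀ j, x (i.succAbove j) ∈ B j (x i)} := by
    ext x
    simp only [slotEvent, B, Set.mem_ofPred_eq, Set.mem_inter_iff, Set.mem_preimage, Set.mem_Ici,
      Fin.forall_iff_succAbove i]
    grind
  have hBreal (j : Fin n) (v : ℝ) : (D (i.succAbove j)).real (B j v) = cdf (D (i.succAbove j))
      (if b (i.succAbove j) < b i then min (t (b (i.succAbove j))) v else v) := by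
    simp only [B]
    split_ifs
    · exact measureReal_Iio_inter_Iic _ _ _
    · exact (cdf_eq_real _ _).symm
  have hmeas : MeasurableSet ((fun x : Fin (n + 1) → ℝ => x i) ⁻¹' Set.Ici c) :=
    measurable_pi_apply i measurableSet_Ici
  have hslice := setIntegral_pi_forall_succAbove_mem D i (g := (Set.Ici c).indicator 1) hBmeas
    ((integrable_const (1 : ℝ)).indicator measurableSet_Ici)
  rw [hevent, ← measureReal_restrict_apply hmeas, ← integral_indicator_one hmeas]
  refine hslice.trans ?_
  rw [← integral_indicator measurableSet_Ici]
  simp only [hBreal]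
  congr with v
  by_cases hv : v ∈ Set.Ici c <;> simp [hv]

end SlotEvent

/-- For i.i.d. uniform values, the probability that the value of step `K` is the largest and at
least `a`, and that the value of each earlier step `j` is below `g j`. -/
noncomputable def slotValue {m : ℕ} (K : Fin m) (a : ℝ) (g : Fin m → ℝ) : ℝ :=
  ∫ w in a..1, w ^ (m - 1 - K : ℕ) * ∏ j ∈ Finset.Iio K, min (g j) w

section SlotValue

variable {m : ℕ}

lemma continuous_slotIntegrand (K : Fin m) (g : Fin m → ℝ) :
    Continuous fun w : ℝ => w ^ (m - 1 - K : ℕ) * ∏ j ∈ Finset.Iio K, min (g j) w := by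
  fun_prop

lemma prod_succAbove_ite_lt {M : Type*} [CommMonoid M] (K : Fin (m + 1)) (f : Fin (m + 1) → M)
    (w : M) : ∏ j : Fin m, (if K.succAbove j < K then f (K.succAbove j) else w) =
      w ^ (m - K : ℕ) * ∏ j ∈ Finset.Iio K, f j := by
  have hcompl : ({K}ᶜ : Finset (Fin (m + 1))) = Finset.Ioi K ∪ Finset.Iio K := by
    ext l
    simp [eq_comm]
  have hdisj : Disjoint (Finset.Ioi K) (Finset.Iio K) :=
    Finset.disjoint_left.2 fun l h h' => (Finset.mem_Ioi.1 h).not_gt (Finset.mem_Iio.1 h')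
  have himage : ∏ j : Fin m, (if K.succAbove j < K then f (K.succAbove j) else w) =
      ∏ l ∈ ({K}ᶜ : Finset (Fin (m + 1))), if l < K then f l else w := by
    rw [← Fin.image_succAbove_univ, Finset.prod_image (Fin.succAbove_right_injective.injOn)]
  rw [himage, hcompl, Finset.prod_union hdisj,
    Finset.prod_congr rfl fun l hl => if_neg (Finset.mem_Ioi.1 hl).not_gt,
    Finset.prod_congr rfl fun l hl => if_pos (Finset.mem_Iio.1 hl), Finset.prod_const, Fin.card_Ioi]
  simp

lemma measureReal_slotEvent_id (μ : Measure ℝ) [IsProbabilityMeasure μ] [NullSingletonClass μ]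
    (K : Fin m) (c : ℝ) (t : Fin m → ℝ) :
    (Measure.pi fun _ : Fin m => μ).real (slotEvent id K c t) =
      slotValue K (cdf μ c) fun j => cdf μ (t j) := by
  obtain _ | m := m
  · exact K.elim0
  rw [slotValue, ← setIntegral_comp_cdf μ (continuous_slotIntegrand K _).measurable,
    measureReal_slotEvent]
  simp only [id, apply_ite (cdf μ), (monotone_cdf μ).map_min, Nat.add_sub_cancel]
  congr with v
  exact prod_succAbove_ite_lt K (fun l => min (cdf μ (t l)) (cdf μ v)) _

lemma iidSuccess_plain_le (μ : Measure ℝ) [IsProbabilityMeasure μ] [NullSingletonClass μ]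
    (σ : Fin m → ℝ) : iidSuccess .plain μ σ ≤
      ∑ K, slotValue K (cdf μ (σ K)) fun j => cdf μ (σ j) := by
  simp only [← measureReal_slotEvent_id]
  refine le_trans (measureReal_mono fun x hx => ?_) (measureReal_iUnion_fintype_le _)
  obtain ⟨K, ⟨hK, hno⟩, hmax⟩ := hx
  exact Set.mem_iUnion.2 ⟨K, hK, hmax, fun l hl => not_le.1 (hno l hl)⟩

lemma continuous_slotValue {X : Type*} [TopologicalSpace X] (K : Fin m) {a : X → ℝ}
    {g : X → Fin m → ℝ} (ha : Continuous a) (hg : Continuous g) :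
    Continuous fun x => slotValue K (a x) (g x) := by
  simp only [slotValue, intervalIntegral.integral_symm 1]
  refine (intervalIntegral.continuous_parametric_intervalIntegral_of_continuous ?_ ha).neg
  simp only [Function.uncurry_def]
  fun_prop

end SlotValue

namespace ThresholdRule

/-- The objective of the rule with thresholds `s` on `m` i.i.d. uniform values; for the record rule
this is its success probability only if the thresholds are antitone. -/
noncomputable def value (r : ThresholdRule) {m : ℕ} (s : Fin m → ℝ) : ℝ :=
  match r with
  | .plain => ∑ K, slotValue K (s K) s
  | .record => ∑ K : Fin m, if (K : ℕ) = 0 then slotValue K (s K) s else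
      (∑ J ∈ Finset.Iio K, slotValue K (s K) fun _ => s J) / (K : ℕ)

lemma continuous_value (r : ThresholdRule) (m : ℕ) : Continuous fun s : Fin m → ℝ => r.value s := by
  cases r with
  | plain =>
    exact continuous_finsetSum _ fun K _ => continuous_slotValue K (by fun_prop) continuous_id
  | record =>
    refine continuous_finsetSum _ fun K _ => ?_
    split_ifs
    · exact continuous_slotValue K (by fun_prop) continuous_id
    · exact (continuous_finsetSum _ fun J _ =>
        continuous_slotValue K (by fun_prop) (by fun_prop)).div_const _

lemma exists_value_ge_of_mem_Icc (r : ThresholdRule) {m : ℕ} {s : Fin m → ℝ}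
    (hs : ∀ k, s k ∈ Set.Icc 0 1) {δ : ℝ} (hδ : 0 < δ) :
    ∃ s' : Fin m → ℝ, (∀ k, s' k ∈ Set.Ioo 0 1) ∧ (Antitone s → Antitone s') ∧
      r.value s - δ ≤ r.value s' := by
  have hlim : Tendsto (fun t : ℝ => r.value fun k => (1 - t) * s k + t / 2) (𝓝[>] 0)
      (𝓝 (r.value s)) := by
    have hcont : Continuous fun t : ℝ => r.value fun k => (1 - t) * s k + t / 2 :=
      (r.continuous_value m).comp (by fun_prop)
    simpa using (hcont.tendsto 0).mono_left (nhdsWithin_le_nhds (s := Set.Ioi (0 : ℝ)))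
  obtain ⟨t, ht, ht0, ht1⟩ := ((hlim.eventually (lt_mem_nhds (sub_lt_self _ hδ))).and
    (Ioo_mem_nhdsGT (zero_lt_one' ℝ))).exists
  refine ⟨_, fun k => ⟨?_, ?_⟩, fun hanti i j hij => ?_, ht.le⟩
  · linarith [mul_nonneg (sub_nonneg.2 ht1.le) (hs k).1]
  · linarith [mul_le_mul_of_nonneg_left (hs k).2 (sub_nonneg.2 ht1.le)]
  · linarith [mul_le_mul_of_nonneg_left (hanti hij) (sub_nonneg.2 ht1.le)]

end ThresholdRule

lemma recordValue_eq_value (m : ℕ) (s : ℕ → ℝ) :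
    recordValue m s = ThresholdRule.record.value fun k : Fin m => s k := by
  rw [recordValue, Finset.sum_range]
  refine Finset.sum_congr rfl fun K _ => ?_
  split_ifs with hK
  · have hempty : Finset.Iio K = ∅ := by
      ext j
      simp [Fin.lt_def, hK]
    simp [slotValue, skipProb, hK, hempty]
  · have hsum (w : ℝ) : ∑ J ∈ Finset.Iio K, min (s J) w ^ (K : ℕ) =
        ∑ J ∈ Finset.range K, min (s J) w ^ (K : ℕ) := by
      rw [← Nat.Iio_eq_range, ← Fin.map_valEmbedding_Iio, Finset.sum_map]
      rfl
    simp only [slotValue]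
    rw [← intervalIntegral.integral_finsetSum (f := fun (J : Fin m) (w : ℝ) =>
        w ^ (m - 1 - K : ℕ) * ∏ _j ∈ Finset.Iio K, min (s J) w) fun J _ =>
      (continuous_slotIntegrand K fun _ => s J).intervalIntegrable _ _,
      ← intervalIntegral.integral_div]
    simp only [skipProb, if_neg hK, Finset.prod_const, Fin.card_Iio, ← Finset.mul_sum, hsum,
      mul_div_assoc]

namespace ThresholdRule

section Blocks

variable {n m : ℕ}

/-- Item `l` has a value `x l` that is acceptable for its block `b l`: it reaches the threshold of
the block and, for the record rule, is not exceeded in any earlier block. -/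
def BlockAccepts (r : ThresholdRule) (τ : Fin m → ℝ) (b : Fin n → Fin m) (x : Fin n → ℝ)
    (l : Fin n) : Prop :=
  match r with
  | .plain => τ (b l) ≤ x l
  | .record => τ (b l) ≤ x l ∧ ∀ j, b j < b l → x j ≤ x l

/-- The item `i` reaches the threshold of its block and no item of an earlier block is
acceptable. -/
def BlockReaches (r : ThresholdRule) (τ : Fin m → ℝ) (b : Fin n → Fin m) (x : Fin n → ℝ)
    (i : Fin n) : Prop :=
  τ (b i) ≤ x i ∧ ∀ l, b l < b i → ¬ r.BlockAccepts τ b x l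

/-- The largest item reaches the threshold of its block, and no other item of this block or of an
earlier one is acceptable. -/
def BlockSelects (r : ThresholdRule) (τ : Fin m → ℝ) (b : Fin n → Fin m) (x : Fin n → ℝ) : Prop :=
  ∃ i, (∀ j, x j ≤ x i) ∧ τ (b i) ≤ x i ∧ ∀ l, l ≠ i → b l ≤ b i → ¬ r.BlockAccepts τ b x l

variable {r : ThresholdRule} {τ : Fin m → ℝ} {b b' : Fin n → Fin m} {x : Fin n → ℝ} {i : Fin n}

lemma BlockSelects.selectsMax (h : r.BlockSelects τ b x) {π : Equiv.Perm (Fin n)}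
    (hmono : Monotone (b ∘ π)) : r.SelectsMax (τ ∘ b ∘ π) fun k => x (π k) := by
  obtain ⟨i, hmax, hτ, hno⟩ := h
  refine ⟨π.symm i, ⟨?_, fun j hj hacc => ?_⟩, fun j => by simpa using hmax _⟩
  · cases r with
    | plain => simpa [Accepts] using hτ
    | record => exact ⟨by simpa using hτ, fun j _ => by simpa using hmax _⟩
  · have hne : π j ≠ i := fun h => hj.ne (by simp [← h])
    have hle : b (π j) ≤ b i := by simpa using hmono hj.le
    refine hno (π j) hne hle ?_
    cases r with
    | plain => exact hacc
    | record =>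
      refine ⟨hacc.1, fun l hl => ?_⟩
      have hlt : π.symm l < j := by
        by_contra! hge
        exact hl.not_ge (by simpa using hmono hge)
      simpa using hacc.2 _ hlt

lemma BlockReaches.not_lt_of_not_blockSelects (hi : ∀ j, x j ≤ x i) (hb : r.BlockReaches τ b x i)
    (hsel : ¬ r.BlockSelects τ b x) (hb' : r.BlockReaches τ b' x i)
    (heq : ∀ l, l ≠ i → b l = b' l) : ¬ b i < b' i := by
  intro hlt
  obtain ⟨l, hl, hle, hacc⟩ : ∃ l, l ≠ i ∧ b l ≤ b i ∧ r.BlockAccepts τ b x l := by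
    by_contra! hnot
    exact hsel ⟨i, hi, hb.1, hnot⟩
  refine hb'.2 l (heq l hl ▸ hle.trans_lt hlt) ?_
  cases r with
  | plain =>
    exact (congrArg τ (heq l hl)).symm.trans_le hacc
  | record =>
    refine ⟨heq l hl ▸ hacc.1, fun j hj => ?_⟩
    rw [← heq l hl] at hj
    by_cases hji : j = i
    · subst hji
      exact absurd (hj.trans_le hle) hlt.not_gt
    · exact hacc.2 j (heq j hji ▸ hj)

/-- If `i` reaches its block but the rule fails, moving `i` to a later block makes it unreachable:
the blocks of the other items leave at most one such block for `i`. -/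
lemma card_blockReaches_le (r : ThresholdRule) (τ : Fin m → ℝ) {x : Fin (n + 1) → ℝ}
    {i : Fin (n + 1)} (hi : ∀ j, x j ≤ x i) :
    Nat.card {b // r.BlockReaches τ b x i} ≤ Nat.card {b // r.BlockSelects τ b x} + m ^ n := by
  classical
  simp only [Nat.card_eq_fintype_card, Fintype.card_subtype]
  set R := Finset.univ.filter fun b : Fin (n + 1) → Fin m => r.BlockReaches τ b x i with hR
  set S := Finset.univ.filter fun b : Fin (n + 1) → Fin m => r.BlockSelects τ b x with hS
  have hcard : (R \ S).card ≤ (Finset.univ : Finset (Fin n → Fin m)).card := by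
    refine Finset.card_le_card_of_injOn (fun b => b ∘ i.succAbove) (fun _ _ => by simp)
      fun b hb b' hb' hbb' => ?_
    simp only [hR, hS, Finset.coe_sdiff, Finset.coe_filter, Finset.mem_univ, true_and,
      Set.mem_sdiff, Set.mem_ofPred_eq] at hb hb'
    have heq (l : Fin (n + 1)) (hl : l ≠ i) : b l = b' l := by
      obtain ⟨j, rfl⟩ := Fin.exists_succAbove_eq hl
      exact congrFun hbb' j
    funext l
    by_cases hl : l = i
    · subst hl
      exact le_antisymm
        (not_lt.1 (hb'.1.not_lt_of_not_blockSelects hi hb'.2 hb.1 fun l hl => (heq l hl).symm))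
        (not_lt.1 (hb.1.not_lt_of_not_blockSelects hi hb.2 hb'.1 heq))
    · exact heq l hl
  rw [Finset.card_univ, Fintype.card_fun, Fintype.card_fin, Fintype.card_fin] at hcard
  have hsdiff : R.card ≤ S.card + (R \ S).card := by
    rw [Finset.card_sdiff]
    have := Finset.card_le_card (Finset.inter_subset_left : S ∩ R ⊆ S)
    omega
  omega

lemma measurableSet_blockSelects (r : ThresholdRule) (τ : Fin m → ℝ) (b : Fin n → Fin m) :
    MeasurableSet {x | r.BlockSelects τ b x} := by
  have hle (i j : Fin n) : Measurable fun x : Fin n → ℝ => x i ≤ x j :=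
    measurableSet_setOfPred.1 (measurableSet_le (measurable_pi_apply i) (measurable_pi_apply j))
  have hτ (c : ℝ) (j : Fin n) : Measurable fun x : Fin n → ℝ => c ≤ x j :=
    measurableSet_setOfPred.1 (measurableSet_le measurable_const (measurable_pi_apply j))
  have hacc (l : Fin n) : Measurable fun x => r.BlockAccepts τ b x l := by
    cases r with
    | plain => exact hτ _ _
    | record => exact (hτ _ _).and (Measurable.forall fun j => measurable_const.imp (hle j l))
  exact measurableSet_setOfPred.2 (Measurable.exists fun i =>
    (Measurable.forall fun j => hle j i).and ((hτ _ _).and (Measurable.forall fun l =>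
      measurable_const.imp (measurable_const.imp (hacc l).not))))

end Blocks

end ThresholdRule

section Relabel

variable {ι κ : Type*} [DecidableEq ι] [LinearOrder κ]

lemma update_lt_iff {b : ι → κ} {t : ι} {J K : κ} (hJ : J < K) (ht : b t < K) (l : ι) :
    Function.update b t J l < K ↔ b l < K := by
  obtain rfl | hl := eq_or_ne l t
  · simp [hJ, ht]
  · simp [hl]

variable [Fintype ι]

/-- Exchanges a block `J` with the block to which `b` assigns the item `top s`, where `s` is the set
of the items in blocks before `K`. -/
def exchangeTop (top : Finset ι → ι) (K : κ) (p : (_ : κ) × (ι → κ)) : (_ : κ) × (ι → κ) :=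
  let s : Finset ι := {l | p.2 l < K}
  if s.Nonempty then ⟨p.2 (top s), Function.update p.2 (top s) p.1⟩ else p

lemma exchangeTop_exchangeTop {top : Finset ι → ι}
    (htop : ∀ s : Finset ι, s.Nonempty → top s ∈ s) {K : κ} {p : (_ : κ) × (ι → κ)}
    (hp : p.1 < K) : exchangeTop top K (exchangeTop top K p) = p := by
  obtain ⟨J, b⟩ := p
  replace hp : J < K := hp
  by_cases hs : ({l | b l < K} : Finset ι).Nonempty
  · have ht : b (top {l | b l < K}) < K := by simpa using htop _ hs
    simp only [exchangeTop, if_pos hs, update_lt_iff hp ht, Function.update_self,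
      Function.update_idem, Function.update_eq_self]
  · simp only [exchangeTop, if_neg hs]

end Relabel

section RecordBlocks

variable {n m : ℕ} {τ : Fin m → ℝ} {x : Fin n → ℝ} {i : Fin n} {K : Fin m}

lemma blockReaches_update_of_forall_lt (hτ : Antitone τ) (hx : Function.Injective x)
    {b : Fin n → Fin m} {J : Fin m} {t : Fin n} (hJ : J < K) (ht : b t < K)
    (hmax : ∀ l, b l < K → x l ≤ x t) (htJ : x t < τ J) (hbi : b i = K) (hK : τ K ≤ x i) :
    Function.update b t J i = K ∧
      ThresholdRule.record.BlockReaches τ (Function.update b t J) x i := by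
  have hit : i ≠ t := fun h => ht.ne (h ▸ hbi)
  have hi : Function.update b t J i = K := by rw [Function.update_of_ne hit, hbi]
  refine ⟨hi, hi ▸ hK, fun l hl hacc => ?_⟩
  have hlK : b l < K := (update_lt_iff hJ ht l).1 (hi ▸ hl)
  have hlt : J < Function.update b t J l := by
    by_contra! hle
    linarith [hτ hle, hacc.1, hmax l hlK]
  have hle : x t ≤ x l := hacc.2 t (by rwa [Function.update_self])
  have heq : l = t := hx ((hmax l hlK).antisymm hle)
  simp [heq] at hlt

lemma exchangeTop_mem (hτ : Antitone τ) (hx : Function.Injective x)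
    {top : Finset (Fin n) → Fin n}
    (htop : ∀ s : Finset (Fin n), s.Nonempty → top s ∈ s ∧ ∀ l ∈ s, x l ≤ x (top s))
    (hK : τ K ≤ x i) {p : (_ : Fin m) × (Fin n → Fin m)} (hp : p.1 < K) (hpi : p.2 i = K)
    (hlow : ∀ l, p.2 l < K → x l < τ p.1) :
    (exchangeTop top K p).1 < K ∧ (exchangeTop top K p).2 i = K ∧
      ThresholdRule.record.BlockReaches τ (exchangeTop top K p).2 x i := by
  obtain ⟨J, b⟩ := p
  simp only at hp hpi hlow
  by_cases hs : ({l | b l < K} : Finset (Fin n)).Nonempty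
  · obtain ⟨hmem, hmax⟩ := htop _ hs
    have ht : b (top {l | b l < K}) < K := by simpa using hmem
    simp only [exchangeTop, if_pos hs]
    exact ⟨ht, blockReaches_update_of_forall_lt hτ hx hp ht (fun l hl => hmax l (by simpa using hl))
      (hlow _ ht) hpi hK⟩
  · simp only [exchangeTop, if_neg hs]
    simp only [Finset.not_nonempty_iff_eq_empty, Finset.filter_eq_empty_iff, Finset.mem_univ,
      true_implies] at hs
    exact ⟨hp, hpi, hpi ▸ hK, fun l hl => absurd (hpi ▸ hl) (@hs l)⟩

/-- Given the other data, the block of the largest item before `K` is uniform, so it may be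
exchanged with an independent uniform block `J`. -/
lemma sum_card_le_mul_card_blockReaches (hτ : Antitone τ) (hx : Function.Injective x)
    (hK : τ K ≤ x i) :
    ∑ J ∈ Finset.Iio K, Nat.card {b : Fin n → Fin m // b i = K ∧ ∀ l, b l < K → x l < τ J} ≤
      K * Nat.card {b // b i = K ∧ ThresholdRule.record.BlockReaches τ b x i} := by
  classical
  have htop (s : Finset (Fin n)) : ∃ t, s.Nonempty → t ∈ s ∧ ∀ l ∈ s, x l ≤ x t := by
    by_cases hs : s.Nonempty
    · obtain ⟨t, ht⟩ := s.exists_max_image x hs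
      exact ⟨t, fun _ => ht⟩
    · exact ⟨i, fun h => absurd h hs⟩
  choose top htop using htop
  simp only [Nat.card_eq_fintype_card, Fintype.card_subtype]
  rw [← Fin.card_Iio K, ← Finset.card_sigma, ← smul_eq_mul, ← Finset.sum_const, ← Finset.card_sigma]
  refine Finset.card_le_card_of_injOn (exchangeTop top K) (fun p hp => ?_) fun p hp q hq hpq => ?_
  · simp only [Finset.mem_coe, Finset.mem_sigma, Finset.mem_Iio, Finset.mem_filter, Finset.mem_univ,
      true_and] at hp ⊢
    exact exchangeTop_mem hτ hx htop hK hp.1 hp.2.1 hp.2.2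
  · simp only [Finset.mem_coe, Finset.mem_sigma, Finset.mem_Iio] at hp hq
    rw [← exchangeTop_exchangeTop (fun s hs => (htop s hs).1) hp.1, hpq,
      exchangeTop_exchangeTop (fun s hs => (htop s hs).1) hq.1]

end RecordBlocks

section Averaging

variable {n m : ℕ} (r : ThresholdRule) (D : Fin n → Measure ℝ) [∀ i, IsProbabilityMeasure (D i)]
  (τ : Fin m → ℝ)

lemma sum_perm_measureReal_blockSelects_le (u : Fin n → Fin m) :
    ∑ ρ : Equiv.Perm (Fin n), (Measure.pi D).real {x | r.BlockSelects τ (u ∘ ρ) x} ≤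
      n.factorial * secretarySuccess r D (τ ∘ u ∘ Tuple.sort u) := by
  have hsort : ∑ ρ : Equiv.Perm (Fin n), (Measure.pi D).real {x | r.BlockSelects τ (u ∘ ρ) x} =
      ∑ π : Equiv.Perm (Fin n),
        (Measure.pi D).real {x | r.BlockSelects τ (u ∘ Tuple.sort u ∘ π.symm) x} :=
    (Fintype.sum_equiv ((Equiv.inv _).trans (Equiv.mulLeft (Tuple.sort u))) _ _ fun π => rfl).symm
  rw [hsort, secretarySuccess, mul_div_cancel₀ _ (Nat.cast_ne_zero.2 n.factorial_ne_zero)]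
  refine Finset.sum_le_sum fun π _ => measureReal_mono fun x hx => ?_
  have hcomp : (u ∘ Tuple.sort u ∘ π.symm) ∘ π = u ∘ Tuple.sort u := by
    funext k
    simp
  have hsel := ThresholdRule.BlockSelects.selectsMax hx (hcomp ▸ Tuple.monotone_sort u)
  rwa [hcomp] at hsel

/-- If the blocks of the items are uniform and independent, their sizes are independent of the order
in which the items are revealed, so some sizes are as good as the average. -/
lemma exists_secretarySuccess_ge (hm : 0 < m) :
    ∃ τ' : Fin n → ℝ,
      (∑ b : Fin n → Fin m, (Measure.pi D).real {x | r.BlockSelects τ b x}) / m ^ n ≤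
        secretarySuccess r D τ' := by
  have : Nonempty (Fin n → Fin m) := ⟨fun _ => ⟨0, hm⟩⟩
  set P : (Fin n → Fin m) → ℝ := fun b => (Measure.pi D).real {x | r.BlockSelects τ b x}
  have hinvariant (ρ : Equiv.Perm (Fin n)) : ∑ u : Fin n → Fin m, P (u ∘ ρ) = ∑ b, P b :=
    (Equiv.arrowCongr ρ.symm (Equiv.refl (Fin m))).sum_comp P
  suffices hsum : ∑ _u : Fin n → Fin m, (∑ b, P b) / m ^ n ≤
      ∑ u : Fin n → Fin m, secretarySuccess r D (τ ∘ u ∘ Tuple.sort u) by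
    obtain ⟨u, -, hu⟩ := Finset.exists_le_of_sum_le Finset.univ_nonempty hsum
    exact ⟨_, hu⟩
  have hfactorial : (0 : ℝ) < n.factorial := by positivity
  rw [Finset.sum_const, Finset.card_univ, Fintype.card_fun, Fintype.card_fin, Fintype.card_fin,
    nsmul_eq_mul, Nat.cast_pow, mul_div_cancel₀ _ (by positivity),
    ← mul_le_mul_iff_right₀ hfactorial]
  calc n.factorial * ∑ b, P b = ∑ ρ : Equiv.Perm (Fin n), ∑ u : Fin n → Fin m, P (u ∘ ρ) := by
        simp only [hinvariant, Finset.sum_const, Finset.card_univ, Fintype.card_perm,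
          Fintype.card_fin, nsmul_eq_mul]
    _ = ∑ u : Fin n → Fin m, ∑ ρ : Equiv.Perm (Fin n), P (u ∘ ρ) := Finset.sum_comm
    _ ≤ ∑ u : Fin n → Fin m, n.factorial * secretarySuccess r D (τ ∘ u ∘ Tuple.sort u) :=
        Finset.sum_le_sum fun u _ => sum_perm_measureReal_blockSelects_le r D τ u
    _ = _ := (Finset.mul_sum _ _ _).symm

end Averaging

section MaxLaw

lemma measurable_iSup_pi {ι : Type*} [Countable ι] : Measurable fun x : ι → ℝ => ⨆ i, x i :=
  Measurable.iSup measurable_pi_apply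

variable {ι : Type*} [Fintype ι]

/-- The distribution of the maximum of independent values with distributions `D`. -/
noncomputable def maxLaw (D : ι → Measure ℝ) : Measure ℝ :=
  (Measure.pi D).map fun x => ⨆ i, x i

variable (D : ι → Measure ℝ) [∀ i, IsProbabilityMeasure (D i)]

instance isProbabilityMeasure_maxLaw : IsProbabilityMeasure (maxLaw D) :=
  Measure.isProbabilityMeasure_map measurable_iSup_pi.aemeasurable

variable [Nonempty ι]

instance nullSingletonClass_maxLaw [∀ i, NullSingletonClass (D i)] :
    NullSingletonClass (maxLaw D) where
  measure_singleton y := by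
    rw [maxLaw, Measure.map_apply measurable_iSup_pi (measurableSet_singleton y)]
    refine measure_mono_null (t := ⋃ i, {x | x i = y}) (fun x hx => ?_)
      (measure_iUnion_null fun i => Measure.pi_hyperplane D i y)
    obtain ⟨i, hi⟩ := exists_eq_ciSup_of_finite (f := x)
    exact Set.mem_iUnion.2 ⟨i, hi.trans hx⟩

lemma cdf_maxLaw (y : ℝ) : cdf (maxLaw D) y = ∏ i, cdf (D i) y := by
  rw [← measureReal_pi_forall_le, cdf_eq_real, maxLaw,
    map_measureReal_apply measurable_iSup_pi measurableSet_Iic]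
  congr with x
  exact ciSup_le_iff (Set.finite_range x).bddAbove

end MaxLaw

lemma integral_maxLaw_le {n : ℕ} (D : Fin (n + 1) → Measure ℝ) [∀ i, IsProbabilityMeasure (D i)]
    {g : ℝ → ℝ} (hmeas : Measurable g) (hnonneg : 0 ≤ g) (hint : ∀ i, Integrable g (D i)) :
    ∫ v, g v ∂maxLaw D ≤ ∑ i, ∫ v, g v * ∏ j, cdf (D (i.succAbove j)) v ∂D i := by
  set A : Fin (n + 1) → Set (Fin (n + 1) → ℝ) := fun i =>
    {x | ∀ j, x (i.succAbove j) ∈ Set.Iic (x i)}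
  have hA (i : Fin (n + 1)) : MeasurableSet (A i) := by
    simp only [A, Set.ofPred_forall]
    exact MeasurableSet.iInter fun j =>
      measurableSet_le (measurable_pi_apply _) (measurable_pi_apply i)
  have hind (i : Fin (n + 1)) :
      Integrable ((A i).indicator fun x => g (x i)) (Measure.pi D) :=
    ((measurePreserving_eval D i).integrable_comp_of_integrable (hint i)).indicator (hA i)
  have hterm (i : Fin (n + 1)) : ∫ x, (A i).indicator (fun x => g (x i)) x ∂Measure.pi D =
      ∫ v, g v * ∏ j, cdf (D (i.succAbove j)) v ∂D i := by
    simp only [integral_indicator (hA i), cdf_eq_real]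
    exact setIntegral_pi_forall_succAbove_mem D i (B := fun _ v => Set.Iic v)
      (fun _ => measurableSet_le measurable_snd measurable_fst) (hint i)
  rw [maxLaw, integral_map measurable_iSup_pi.aemeasurable hmeas.aestronglyMeasurable]
  simp only [← hterm]
  rw [← integral_finsetSum _ fun i _ => hind i]
  refine integral_mono_of_nonneg (Eventually.of_forall fun x => hnonneg _)
    (integrable_finsetSum _ fun i _ => hind i) (Eventually.of_forall fun x => ?_)
  obtain ⟨i, hi⟩ := exists_eq_ciSup_of_finite (f := x)
  have hmem : x ∈ A i := fun j => (le_ciSup (Set.finite_range x).bddAbove _).trans_eq hi.symm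
  calc g (⨆ i, x i) = (A i).indicator (fun x => g (x i)) x := by
        rw [Set.indicator_of_mem hmem, hi]
    _ ≤ ∑ i, (A i).indicator (fun x => g (x i)) x :=
        Finset.single_le_sum (f := fun i => (A i).indicator (fun x => g (x i)) x)
          (fun i _ => Set.indicator_nonneg (fun x _ => hnonneg _) x) (Finset.mem_univ i)

lemma card_mul_prod_rpow_inv_le_sum {ι : Type*} [Fintype ι] {p : ι → ℝ} (hp : ∀ k, 0 ≤ p k) :
    Fintype.card ι * ∏ k, p k ^ (Fintype.card ι : ℝ)⁻¹ ≤ ∑ k, p k := by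
  obtain h | h := isEmpty_or_nonempty ι
  · simp
  have hcard : (0 : ℝ) < Fintype.card ι := Nat.cast_pos.2 Fintype.card_pos
  have hamgm := Real.geom_mean_le_arith_mean_weighted Finset.univ
    (fun _ : ι => (Fintype.card ι : ℝ)⁻¹) p (fun _ _ => by positivity) (by simp [hcard.ne'])
    fun k _ => hp k
  rwa [← Finset.mul_sum, ← div_eq_inv_mul, le_div_iff₀' hcard] at hamgm

lemma prod_ite_lt {M : Type*} [CommMonoid M] {m : ℕ} (K : Fin m) (f : Fin m → M) (w : M) :
    ∏ k, (if k < K then f k else w) = w ^ (m - K : ℕ) * ∏ k ∈ Finset.Iio K, f k := by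
  have hlt : Finset.univ.filter (fun k => k < K) = Finset.Iio K := by
    ext k
    simp
  have hge : Finset.univ.filter (fun k => ¬ k < K) = Finset.Ici K := by
    ext k
    simp
  rw [Finset.prod_ite, Finset.prod_const, hlt, hge, Fin.card_Ici, mul_comm]

/-- Here `F l k` is the distribution function of item `l` at the bound imposed on the items of block
`k`, and `q` is that of item `i` at the maximum. The left-hand side belongs to i.i.d. items. -/
lemma pow_mul_prod_le_prod_sum_mul {n m : ℕ} (hm : 0 < m) (i : Fin (n + 1))
    {F : Fin (n + 1) → Fin m → ℝ} {q : ℝ} {z : Fin m → ℝ} (hF : ∀ l k, 0 ≤ F l k)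
    (hFq : ∀ k, F i k ≤ q) (hz : ∀ k, 0 ≤ z k) (hzF : ∀ k, ∏ l, F l k = z k ^ m) :
    m ^ n * ∏ k, z k ≤ (∏ j : Fin n, ∑ k, F (i.succAbove j) k) * q := by
  have hq : 0 ≤ q := (hF i ⟨0, hm⟩).trans (hFq ⟨0, hm⟩)
  have hroot (k : Fin m) :
      z k ≤ (∏ j : Fin n, F (i.succAbove j) k ^ (m : ℝ)⁻¹) * q ^ (m : ℝ)⁻¹ := by
    rw [Real.finsetProd_rpow _ _ fun j _ => hF _ _,
      ← Real.mul_rpow (Finset.prod_nonneg fun j _ => hF _ _) hq,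
      ← Real.pow_rpow_inv_natCast (hz k) hm.ne', ← hzF k, Fin.prod_univ_succAbove _ i, mul_comm]
    have hrest : 0 ≤ ∏ j, F (i.succAbove j) k := Finset.prod_nonneg fun j _ => hF _ _
    exact Real.rpow_le_rpow (mul_nonneg hrest (hF i k))
      (mul_le_mul_of_nonneg_left (hFq k) hrest) (by positivity)
  have hprod : ∏ k, z k ≤ (∏ j : Fin n, ∏ k, F (i.succAbove j) k ^ (m : ℝ)⁻¹) * q := by
    refine (Finset.prod_le_prod (fun k _ => hz k) fun k _ => hroot k).trans_eq ?_
    rw [Finset.prod_mul_distrib, Finset.prod_const, Finset.card_univ, Fintype.card_fin,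
      Real.rpow_inv_natCast_pow hq hm.ne', Finset.prod_comm]
  calc m ^ n * ∏ k, z k
      ≤ m ^ n * ((∏ j : Fin n, ∏ k, F (i.succAbove j) k ^ (m : ℝ)⁻¹) * q) := by gcongr
    _ = (∏ j : Fin n, (m * ∏ k, F (i.succAbove j) k ^ (m : ℝ)⁻¹)) * q := by
        rw [Finset.prod_mul_distrib, Finset.prod_const, Finset.card_univ, Fintype.card_fin,
          mul_assoc]
    _ ≤ (∏ j : Fin n, ∑ k, F (i.succAbove j) k) * q := by
        refine mul_le_mul_of_nonneg_right (Finset.prod_le_prod (fun j _ => mul_nonneg m.cast_nonneg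
          (Finset.prod_nonneg fun k _ => Real.rpow_nonneg (hF _ _) _)) fun j _ => ?_) hq
        simpa only [Fintype.card_fin] using card_mul_prod_rpow_inv_le_sum (hF (i.succAbove j))

/-- If `m` i.i.d. values are uniform and their maximum, attained at step `K`, is `w`, so that `u` is
the quantile `w ^ m` of the maximum, the conditional probability that the value of each earlier step
`k` is below `g k`. -/
noncomputable def slotRatio {m : ℕ} (K : Fin m) (g : Fin m → ℝ) (u : ℝ) : ℝ :=
  ∏ k ∈ Finset.Iio K, min (g k) (u ^ (m : ℝ)⁻¹) / u ^ (m : ℝ)⁻¹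

section SlotRatio

variable {m : ℕ} (K : Fin m) (g : Fin m → ℝ)

lemma measurable_slotRatio : Measurable (slotRatio K g) :=
  Finset.measurable_prod _ fun _ _ =>
    (measurable_const.min (measurable_id.pow_const _)).div (measurable_id.pow_const _)

variable {g} in
lemma slotRatio_mem_Icc (hg : ∀ k, 0 ≤ g k) {u : ℝ} (hu : 0 ≤ u) :
    slotRatio K g u ∈ Set.Icc 0 1 := by
  have hroot : 0 ≤ u ^ (m : ℝ)⁻¹ := Real.rpow_nonneg hu _
  have hnonneg (k : Fin m) : 0 ≤ min (g k) (u ^ (m : ℝ)⁻¹) / u ^ (m : ℝ)⁻¹ :=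
    div_nonneg (le_min (hg k) hroot) hroot
  exact ⟨Finset.prod_nonneg fun k _ => hnonneg k, Finset.prod_le_one (fun k _ => hnonneg k)
    fun k _ => div_le_one_of_le₀ (min_le_right _ _) hroot⟩

lemma slotRatio_pow {w : ℝ} (hw : 0 ≤ w) :
    slotRatio K g (w ^ m) = (∏ k ∈ Finset.Iio K, min (g k) w) / w ^ (K : ℕ) := by
  rw [slotRatio, Real.pow_rpow_inv_natCast hw K.pos.ne', Finset.prod_div_distrib, Finset.prod_const,
    Fin.card_Iio]

lemma integral_slotRatio {a : ℝ} (ha : a ∈ Set.Ioc (0 : ℝ) 1) :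
    ∫ u in (a ^ m)..1, slotRatio K g u = m * slotValue K a g := by
  have hpos {w : ℝ} (hw : w ∈ Set.uIcc a 1) : 0 < w := by
    rw [Set.uIcc_of_le ha.2] at hw
    exact ha.1.trans_le hw.1
  have hcont : ContinuousOn (slotRatio K g) ((fun w => w ^ m) '' Set.uIcc a 1) := by
    have hroot : Continuous fun u : ℝ => u ^ (m : ℝ)⁻¹ := Real.continuous_rpow_const (by positivity)
    refine continuousOn_finsetProd _ fun k _ =>
      (continuous_const.min hroot).continuousOn.div hroot.continuousOn ?_
    rintro u ⟨w, hw, rfl⟩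
    exact (Real.rpow_pos_of_pos (pow_pos (hpos hw) m) _).ne'
  have hsubst := intervalIntegral.integral_comp_mul_deriv' (f := fun w : ℝ => w ^ m)
    (f' := fun w => (m : ℝ) * w ^ (m - 1)) (fun w _ => hasDerivAt_pow m w) (by fun_prop) hcont
  rw [one_pow] at hsubst
  rw [← hsubst, slotValue, ← intervalIntegral.integral_const_mul]
  refine intervalIntegral.integral_congr fun w hw => ?_
  have hpow : w ^ (m - 1) = w ^ (m - 1 - K : ℕ) * w ^ (K : ℕ) := by
    rw [← pow_add, Nat.sub_add_cancel (Nat.le_sub_one_of_lt K.2)]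
  have hw0 : 0 < w := hpos hw
  simp only [Function.comp_apply, slotRatio_pow K g hw0.le, hpow]
  field_simp

end SlotRatio

lemma sum_filter_removeNth {κ M : Type*} [Fintype κ] [DecidableEq κ] [AddCommMonoid M] {n : ℕ}
    (i : Fin (n + 1)) (K : κ) (f : (Fin n → κ) → M) :
    ∑ b : Fin (n + 1) → κ with b i = K, f (i.removeNth b) = ∑ c, f c := by
  refine Finset.sum_bij' (fun b _ => i.removeNth b) (fun c _ => i.insertNth K c)
    (fun _ _ => Finset.mem_univ _) (fun c _ => by simp) (fun b hb => ?_) (fun c _ => by simp)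
    fun _ _ => rfl
  rw [← (Finset.mem_filter.1 hb).2]
  exact Fin.insertNth_self_removeNth i b

lemma integrable_prod_cdf_comp {ι : Type*} [Fintype ι] (ν : ι → Measure ℝ) (μ : Measure ℝ)
    [IsFiniteMeasure μ] {y : ι → ℝ → ℝ} (hy : ∀ j, Measurable (y j)) :
    Integrable (fun v => ∏ j, cdf (ν j) (y j v)) μ := by
  refine Integrable.of_bound (Finset.measurable_prod _ fun j _ =>
    (monotone_cdf (ν j)).measurable.comp (hy j)).aestronglyMeasurable 1
    (Eventually.of_forall fun v => ?_)
  rw [Real.norm_of_nonneg (Finset.prod_nonneg fun _ _ => cdf_nonneg _ _)]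
  exact Finset.prod_le_one (fun _ _ => cdf_nonneg _ _) fun _ _ => cdf_le_one _ _

lemma measurable_ite_min (p : Prop) [Decidable p] (s : ℝ) :
    Measurable fun v : ℝ => if p then min s v else v := by
  split_ifs
  exacts [measurable_const.min measurable_id, measurable_id]

section Comparison

variable {n m : ℕ} {D : Fin (n + 1) → Measure ℝ} [∀ i, IsProbabilityMeasure (D i)]
  {K : Fin m} {g t : Fin m → ℝ} {a c : ℝ}

lemma pow_mul_slotRatio_mul_prod_cdf_le (hg : ∀ k, 0 ≤ g k)
    (ht : ∀ k, cdf (maxLaw D) (t k) = g k ^ m) {v : ℝ} (hv : 0 < cdf (maxLaw D) v)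
    (i : Fin (n + 1)) :
    m ^ n * (slotRatio K g (cdf (maxLaw D) v) * ∏ j, cdf (D (i.succAbove j)) v) ≤
      ∏ j, ∑ k, cdf (D (i.succAbove j)) (if k < K then min (t k) v else v) := by
  obtain ⟨w, hw, hwv⟩ : ∃ w : ℝ, 0 < w ∧ w ^ m = cdf (maxLaw D) v :=
    ⟨_, Real.rpow_pos_of_pos hv _, Real.rpow_inv_natCast_pow hv.le K.pos.ne'⟩
  have hfactor : w ^ m = cdf (D i) v * ∏ j, cdf (D (i.succAbove j)) v := by
    rw [hwv, cdf_maxLaw, Fin.prod_univ_succAbove _ i]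
  have hpos : 0 < cdf (D i) v := (cdf_nonneg _ _).lt_of_ne' fun h => by
    rw [h, zero_mul] at hfactor
    exact (pow_pos hw m).ne' hfactor
  have hblocks := pow_mul_prod_le_prod_sum_mul K.pos i (q := cdf (D i) v)
    (F := fun l k => cdf (D l) (if k < K then min (t k) v else v))
    (z := fun k => if k < K then min (g k) w else w)
    (fun _ _ => cdf_nonneg _ _)
    (fun k => monotone_cdf _ (by split_ifs; exacts [min_le_right _ _, le_rfl]))
    (fun k => by split_ifs; exacts [le_min (hg k) hw.le, hw.le])
    (fun k => by
      rw [← cdf_maxLaw]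
      split_ifs
      · rw [(monotone_cdf _).map_min, ht, ← hwv]
        exact ((pow_left_monotoneOn (n := m)).map_min (hg k) hw.le).symm
      · exact hwv.symm)
  rw [prod_ite_lt] at hblocks
  refine le_of_mul_le_mul_right (Eq.trans_le ?_ hblocks) hpos
  rw [← hwv, slotRatio_pow K g hw.le, mul_assoc, mul_assoc, mul_comm (∏ j, _), ← hfactor,
    ← pow_sub_mul_pow w K.2.le]
  field_simp

variable [∀ i, NullSingletonClass (D i)]

variable (D K t c) in
lemma sum_measureReal_slotEvent (i : Fin (n + 1)) :
    ∑ b : Fin (n + 1) → Fin m with b i = K, (Measure.pi D).real (slotEvent b i c t) =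
      ∫ v in Set.Ici c, ∏ j, ∑ k, cdf (D (i.succAbove j)) (if k < K then min (t k) v else v)
        ∂D i := by
  calc ∑ b : Fin (n + 1) → Fin m with b i = K, (Measure.pi D).real (slotEvent b i c t)
      = ∑ b : Fin (n + 1) → Fin m with b i = K, ∫ v in Set.Ici c, ∏ j, cdf (D (i.succAbove j))
          (if i.removeNth b j < K then min (t (i.removeNth b j)) v else v) ∂D i := by
        refine Finset.sum_congr rfl fun b hb => ?_
        rw [measureReal_slotEvent, (Finset.mem_filter.1 hb).2]
        rfl
    _ = ∑ b : Fin n → Fin m, ∫ v in Set.Ici c, ∏ j, cdf (D (i.succAbove j))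
          (if b j < K then min (t (b j)) v else v) ∂D i :=
        sum_filter_removeNth i K fun b => ∫ v in Set.Ici c, ∏ j, cdf (D (i.succAbove j))
          (if b j < K then min (t (b j)) v else v) ∂D i
    _ = _ := by
        rw [← integral_finsetSum _ fun b _ =>
          integrable_prod_cdf_comp _ _ fun j => measurable_ite_min _ _]
        simp only [Finset.prod_univ_sum, Fintype.piFinset_univ]

lemma mul_slotValue_le_sum_setIntegral (ha : a ∈ Set.Ioc 0 1) (hg : ∀ k, 0 ≤ g k)
    (hc : cdf (maxLaw D) c = a ^ m) :
    m * slotValue K a g ≤ ∑ i, ∫ v in Set.Ici c,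
      slotRatio K g (cdf (maxLaw D) v) * ∏ j, cdf (D (i.succAbove j)) v ∂D i := by
  have hratio (v : ℝ) := slotRatio_mem_Icc K hg (cdf_nonneg (maxLaw D) v)
  have hmeas : Measurable fun v => slotRatio K g (cdf (maxLaw D) v) :=
    (measurable_slotRatio K g).comp (monotone_cdf _).measurable
  have hint (i : Fin (n + 1)) : Integrable (fun v => slotRatio K g (cdf (maxLaw D) v)) (D i) :=
    Integrable.of_bound hmeas.aestronglyMeasurable 1 (Eventually.of_forall fun v =>
      (Real.norm_of_nonneg (hratio v).1).trans_le (hratio v).2)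
  calc m * slotValue K a g = ∫ v in Set.Ici c, slotRatio K g (cdf (maxLaw D) v) ∂maxLaw D := by
        rw [setIntegral_comp_cdf (maxLaw D) (measurable_slotRatio K g), hc,
          integral_slotRatio K g ha]
    _ ≤ ∑ i, ∫ v, (Set.Ici c).indicator (fun v => slotRatio K g (cdf (maxLaw D) v)) v *
          ∏ j, cdf (D (i.succAbove j)) v ∂D i := by
        rw [← integral_indicator measurableSet_Ici]
        exact integral_maxLaw_le D (hmeas.indicator measurableSet_Ici)
          (Set.indicator_nonneg fun v _ => (hratio v).1)
          fun i => (hint i).indicator measurableSet_Ici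
    _ = ∑ i, ∫ v in Set.Ici c,
          slotRatio K g (cdf (maxLaw D) v) * ∏ j, cdf (D (i.succAbove j)) v ∂D i := by
        simp only [← integral_indicator measurableSet_Ici, Set.indicator_mul_left]

lemma pow_mul_slotValue_le_sum (ha : a ∈ Set.Ioc 0 1) (hg : ∀ k, 0 ≤ g k)
    (hc : cdf (maxLaw D) c = a ^ m) (ht : ∀ k, cdf (maxLaw D) (t k) = g k ^ m) :
    m ^ (n + 1) * slotValue K a g ≤ ∑ i, ∑ b : Fin (n + 1) → Fin m with b i = K,
      (Measure.pi D).real (slotEvent b i c t) := by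
  calc (m : ℝ) ^ (n + 1) * slotValue K a g = m ^ n * (m * slotValue K a g) := by ring
    _ ≤ m ^ n * ∑ i, ∫ v in Set.Ici c,
          slotRatio K g (cdf (maxLaw D) v) * ∏ j, cdf (D (i.succAbove j)) v ∂D i := by
        gcongr
        exact mul_slotValue_le_sum_setIntegral ha hg hc
    _ = ∑ i, ∫ v in Set.Ici c,
          m ^ n * (slotRatio K g (cdf (maxLaw D) v) * ∏ j, cdf (D (i.succAbove j)) v) ∂D i := by
        simp only [Finset.mul_sum, integral_const_mul]
    _ ≤ _ := Finset.sum_le_sum fun i _ => ?_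
  rw [sum_measureReal_slotEvent]
  refine integral_mono_of_nonneg (Eventually.of_forall fun v => ?_) ?_
    ((ae_restrict_iff' measurableSet_Ici).2 (Eventually.of_forall fun v hv =>
      pow_mul_slotRatio_mul_prod_cdf_le hg ht ?_ i))
  · exact mul_nonneg (by positivity) (mul_nonneg (slotRatio_mem_Icc K hg (cdf_nonneg _ v)).1
      (Finset.prod_nonneg fun _ _ => cdf_nonneg _ _))
  · simp only [Finset.prod_univ_sum, Fintype.piFinset_univ]
    exact integrable_finsetSum _ fun b _ =>
      integrable_prod_cdf_comp _ _ fun j => measurable_ite_min _ _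
  · exact (hc ▸ pow_pos ha.1 m).trans_le (monotone_cdf _ hv)

end Comparison

lemma natCard_subtype_mono {β : Type*} [Finite β] {P Q : β → Prop} (h : ∀ b, P b → Q b) :
    Nat.card {b // P b} ≤ Nat.card {b // Q b} :=
  Nat.card_mono (Set.toFinite {b | Q b}) h

lemma natCard_subtype_eq_sum_fiber {β κ : Type*} [Finite β] [Fintype κ] (f : β → κ)
    (P : β → Prop) : Nat.card {b // P b} = ∑ k, Nat.card {b // f b = k ∧ P b} := by
  classical
  have := Fintype.ofFinite β
  simp only [Nat.card_eq_fintype_card, Fintype.card_subtype]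
  rw [Finset.card_eq_sum_card_fiberwise (f := f) (t := Finset.univ) fun _ _ => by simp]
  simp only [Finset.filter_filter, and_comm]

lemma natCard_mem_eq_sum_indicator {β Ω : Type*} [Fintype β] (S : β → Set Ω) (x : Ω) :
    (Nat.card {b // x ∈ S b} : ℝ) = ∑ b, (S b).indicator 1 x := by
  classical
  simp [Nat.card_eq_fintype_card, Fintype.card_subtype, Set.indicator_apply]

section Counting

variable {β Ω : Type*} [MeasurableSpace Ω] (μ : Measure Ω) [IsFiniteMeasure μ]
  {S : β → Set Ω}

lemma integrable_natCard_mem [Finite β] (hS : ∀ b, MeasurableSet (S b)) :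
    Integrable (fun x => (Nat.card {b // x ∈ S b} : ℝ)) μ := by
  have := Fintype.ofFinite β
  simp only [natCard_mem_eq_sum_indicator]
  exact integrable_finsetSum _ fun b _ => (integrable_const 1).indicator (hS b)

lemma integral_natCard_mem [Fintype β] (hS : ∀ b, MeasurableSet (S b)) :
    ∫ x, (Nat.card {b // x ∈ S b} : ℝ) ∂μ = ∑ b, μ.real (S b) := by
  simp only [natCard_mem_eq_sum_indicator]
  have hint (b : β) : Integrable ((S b).indicator (1 : Ω → ℝ)) μ :=
    (integrable_const (1 : ℝ)).indicator (hS b)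
  rw [integral_finsetSum _ fun b _ => hint b]
  exact Finset.sum_congr rfl fun b _ => integral_indicator_one (hS b)

end Counting

/-- The number of pairs of an item and an assignment of the items to blocks that puts this item into
block `K` and for which `slotEvent` occurs. -/
noncomputable def slotCount {n m : ℕ} (K : Fin m) (c : ℝ) (t : Fin m → ℝ) (x : Fin n → ℝ) : ℝ :=
  ∑ i, ∑ b : Fin n → Fin m with b i = K, (slotEvent b i c t).indicator 1 x

namespace ThresholdRule

/-- The counterpart of `ThresholdRule.value` for the assignments of the items `x` to blocks. -/
noncomputable def blockCount (r : ThresholdRule) {n m : ℕ} (τ : Fin m → ℝ) (x : Fin n → ℝ) : ℝ :=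
  match r with
  | .plain => ∑ K, slotCount K (τ K) τ x
  | .record => ∑ K : Fin m, if (K : ℕ) = 0 then slotCount K (τ K) τ x else
      (∑ J ∈ Finset.Iio K, slotCount K (τ K) (fun _ => τ J) x) / (K : ℕ)

end ThresholdRule

section BlockCount

variable {n m : ℕ} {τ : Fin m → ℝ} {x : Fin n → ℝ} {i : Fin n}

lemma slotCount_le (K : Fin m) (c : ℝ) (t : Fin m → ℝ) (hx : Function.Injective x)
    (hi : ∀ j, x j ≤ x i) :
    slotCount K c t x ≤
      Nat.card {b : Fin n → Fin m // b i = K ∧ c ≤ x i ∧ ∀ l, b l < K → x l < t (b l)} := by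
  classical
  have hother (j : Fin n) (hj : j ≠ i) :
      ∑ b : Fin n → Fin m with b j = K, (slotEvent b j c t).indicator (1 : (Fin n → ℝ) → ℝ) x = 0 :=
    Finset.sum_eq_zero fun b _ =>
      Set.indicator_of_notMem (fun hmem => hj (hx ((hi j).antisymm (hmem.2.1 i)))) _
  rw [slotCount, Finset.sum_eq_single i (fun j _ => hother j) (by simp), Nat.card_eq_fintype_card,
    Fintype.card_subtype, ← Finset.filter_filter, Finset.card_filter, Nat.cast_sum]
  refine Finset.sum_le_sum fun b hb => Set.indicator_apply_le' (fun hmem => ?_) fun _ => ?_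
  · obtain ⟨hc, -, hlow⟩ := hmem
    rw [(Finset.mem_filter.1 hb).2] at hlow
    rw [if_pos ⟨hc, hlow⟩, Nat.cast_one, Pi.one_apply]
  · exact Nat.cast_nonneg _

lemma sum_slotCount_div_le (hτ : Antitone τ) (hx : Function.Injective x) (hi : ∀ j, x j ≤ x i)
    (K : Fin m) :
    (∑ J ∈ Finset.Iio K, slotCount K (τ K) (fun _ => τ J) x) / (K : ℕ) ≤
      Nat.card {b // b i = K ∧ ThresholdRule.record.BlockReaches τ b x i} := by
  refine div_le_of_le_mul₀ (Nat.cast_nonneg _) (Nat.cast_nonneg _) ?_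
  have hslot (J : Fin m) := slotCount_le K (τ K) (fun _ => τ J) hx hi
  by_cases hK : τ K ≤ x i
  · calc ∑ J ∈ Finset.Iio K, slotCount K (τ K) (fun _ => τ J) x
        ≤ ∑ J ∈ Finset.Iio K,
            (Nat.card {b : Fin n → Fin m // b i = K ∧ ∀ l, b l < K → x l < τ J} : ℝ) :=
          Finset.sum_le_sum fun J _ => (hslot J).trans
            (Nat.cast_le.2 (natCard_subtype_mono fun b hb => ⟨hb.1, hb.2.2⟩))
      _ ≤ _ := by
          rw [mul_comm]
          exact_mod_cast sum_card_le_mul_card_blockReaches hτ hx hK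
  · refine (Finset.sum_nonpos fun J _ => ?_).trans (by positivity)
    simpa [hK] using hslot J

lemma blockCount_le_card_blockReaches {r : ThresholdRule} (hτ : r = .record → Antitone τ)
    (hx : Function.Injective x) (hi : ∀ j, x j ≤ x i) :
    r.blockCount τ x ≤ Nat.card {b // r.BlockReaches τ b x i} := by
  rw [natCard_subtype_eq_sum_fiber (fun b => b i), Nat.cast_sum]
  cases r with
  | plain =>
    refine Finset.sum_le_sum fun K _ => (slotCount_le K (τ K) τ hx hi).trans
      (Nat.cast_le.2 (natCard_subtype_mono ?_))
    rintro b ⟨rfl, hc, hlow⟩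
    exact ⟨rfl, hc, fun l hl => not_le.2 (hlow l hl)⟩
  | record =>
    refine Finset.sum_le_sum fun K _ => ?_
    split_ifs with hK
    · refine (slotCount_le K (τ K) τ hx hi).trans (Nat.cast_le.2 (natCard_subtype_mono ?_))
      rintro b ⟨rfl, hc, -⟩
      exact ⟨rfl, hc, fun l hl => absurd hl (by simp [Fin.lt_def, hK])⟩
    · exact sum_slotCount_div_le (hτ rfl) hx hi K

end BlockCount

section Integral

variable {n m : ℕ} (D : Fin n → Measure ℝ) [∀ i, IsProbabilityMeasure (D i)]

lemma integrable_indicator_slotEvent (b : Fin n → Fin m) (i : Fin n) (c : ℝ) (t : Fin m → ℝ) :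
    Integrable ((slotEvent b i c t).indicator (1 : (Fin n → ℝ) → ℝ)) (Measure.pi D) :=
  (integrable_const (1 : ℝ)).indicator (measurableSet_slotEvent c t b i)

lemma integrable_slotCount (K : Fin m) (c : ℝ) (t : Fin m → ℝ) :
    Integrable (slotCount K c t) (Measure.pi D) :=
  integrable_finsetSum _ fun i _ => integrable_finsetSum _ fun b _ =>
    integrable_indicator_slotEvent D b i c t

lemma integral_slotCount (K : Fin m) (c : ℝ) (t : Fin m → ℝ) :
    ∫ x, slotCount K c t x ∂Measure.pi D =
      ∑ i, ∑ b : Fin n → Fin m with b i = K, (Measure.pi D).real (slotEvent b i c t) := by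
  simp only [slotCount]
  rw [integral_finsetSum _ fun i _ => integrable_finsetSum _ fun b _ =>
    integrable_indicator_slotEvent D b i c t]
  refine Finset.sum_congr rfl fun i _ => ?_
  rw [integral_finsetSum _ fun b _ => integrable_indicator_slotEvent D b i c t]
  exact Finset.sum_congr rfl fun b _ => integral_indicator_one (measurableSet_slotEvent c t b i)

lemma integrable_sum_slotCount_div (K : Fin m) (c : ℝ) (τ : Fin m → ℝ) :
    Integrable (fun x => (∑ J ∈ Finset.Iio K, slotCount K c (fun _ => τ J) x) / (K : ℕ))
      (Measure.pi D) :=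
  (integrable_finsetSum _ fun J _ => integrable_slotCount D K c fun _ => τ J).div_const _

lemma integrable_blockCount (r : ThresholdRule) (τ : Fin m → ℝ) :
    Integrable (r.blockCount τ) (Measure.pi D) := by
  cases r with
  | plain => exact integrable_finsetSum _ fun K _ => integrable_slotCount D K _ _
  | record =>
    refine integrable_finsetSum _ fun K _ => ?_
    split_ifs
    · exact integrable_slotCount D K _ _
    · exact integrable_sum_slotCount_div D K _ _

end Integral

lemma exists_forall_cdf_eq {ι : Type*} [Preorder ι] (μ : Measure ℝ) [IsProbabilityMeasure μ]
    [NullSingletonClass μ] {p : ι → ℝ} (hp : ∀ k, p k ∈ Set.Ioo 0 1) :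
    ∃ τ : ι → ℝ, (∀ k, cdf μ (τ k) = p k) ∧ (Antitone p → Antitone τ) := by
  choose q hq using fun y : Set.Ioo (0 : ℝ) 1 => exists_cdf_eq μ y.2
  refine ⟨fun k => q ⟨p k, hp k⟩, fun k => hq _, fun hanti i j hij => ?_⟩
  rcases (hanti hij).eq_or_lt with h | h
  · simp only [h, le_refl]
  · exact ((monotone_cdf μ).reflect_lt (by rwa [hq, hq])).le

section Transfer

variable {n : ℕ} (D : Fin (n + 1) → Measure ℝ) [∀ i, IsProbabilityMeasure (D i)]
  [∀ i, NullSingletonClass (D i)] (r : ThresholdRule) {m : ℕ}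

lemma integral_blockCount_le {τ : Fin m → ℝ} (hτ : r = .record → Antitone τ) :
    ∫ x, r.blockCount τ x ∂Measure.pi D ≤
      (∑ b : Fin (n + 1) → Fin m, (Measure.pi D).real {x | r.BlockSelects τ b x}) + m ^ n := by
  have hint : Integrable (fun x => (Nat.card {b // r.BlockSelects τ b x} : ℝ)) (Measure.pi D) :=
    integrable_natCard_mem _ (r.measurableSet_blockSelects τ)
  have hle : ∀ᵐ x ∂Measure.pi D,
      r.blockCount τ x ≤ Nat.card {b // r.BlockSelects τ b x} + (m : ℝ) ^ n := by
    filter_upwards [ae_injective_pi D] with x hx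
    obtain ⟨i, hi⟩ := Finite.exists_max x
    refine (blockCount_le_card_blockReaches hτ hx hi).trans ?_
    exact_mod_cast r.card_blockReaches_le τ hi
  calc ∫ x, r.blockCount τ x ∂Measure.pi D
      ≤ ∫ x, (Nat.card {b // r.BlockSelects τ b x} + (m : ℝ) ^ n) ∂Measure.pi D :=
        integral_mono_ae (integrable_blockCount D r τ) (hint.add (integrable_const _)) hle
    _ = _ := by
        rw [integral_add hint (integrable_const _), integral_const, probReal_univ, one_smul]
        congr 1
        exact integral_natCard_mem _ (r.measurableSet_blockSelects τ)

lemma pow_mul_value_le_integral_blockCount {s τ : Fin m → ℝ} (hs : ∀ k, s k ∈ Set.Ioo 0 1)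
    (hτ : ∀ k, cdf (maxLaw D) (τ k) = s k ^ m) :
    m ^ (n + 1) * r.value s ≤ ∫ x, r.blockCount τ x ∂Measure.pi D := by
  have hslot (K : Fin m) {g t : Fin m → ℝ} (hg : ∀ k, 0 ≤ g k)
      (ht : ∀ k, cdf (maxLaw D) (t k) = g k ^ m) :
      m ^ (n + 1) * slotValue K (s K) g ≤ ∫ x, slotCount K (τ K) t x ∂Measure.pi D := by
    rw [integral_slotCount]
    exact pow_mul_slotValue_le_sum (Set.Ioo_subset_Ioc_self (hs K)) hg (hτ K) ht
  cases r with
  | plain =>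
    simp only [ThresholdRule.value, ThresholdRule.blockCount]
    rw [integral_finsetSum _ fun K _ => integrable_slotCount D K _ _, Finset.mul_sum]
    exact Finset.sum_le_sum fun K _ => hslot K (fun k => (hs k).1.le) hτ
  | record =>
    simp only [ThresholdRule.value, ThresholdRule.blockCount]
    rw [integral_finsetSum, Finset.mul_sum]
    · refine Finset.sum_le_sum fun K _ => ?_
      split_ifs
      · exact hslot K (fun k => (hs k).1.le) hτ
      · rw [integral_div, integral_finsetSum _ fun J _ => integrable_slotCount D K _ _,
          ← mul_div_assoc, Finset.mul_sum]
        gcongr with J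
        exact hslot K (fun _ => (hs J).1.le) fun _ => hτ J
    · intro K _
      split_ifs
      · exact integrable_slotCount D K _ _
      · exact integrable_sum_slotCount_div D K _ _

lemma exists_secretarySuccess_ge_value (hm : 0 < m) {s : Fin m → ℝ}
    (hs : ∀ k, s k ∈ Set.Icc 0 1) (hanti : r = .record → Antitone s) {δ : ℝ} (hδ : 0 < δ) :
    ∃ τ : Fin (n + 1) → ℝ, r.value s - 1 / m - δ ≤ secretarySuccess r D τ := by
  obtain ⟨s', hs', hanti', hval⟩ := r.exists_value_ge_of_mem_Icc hs hδ
  obtain ⟨τ, hτ, hτanti⟩ := exists_forall_cdf_eq (maxLaw D) (p := fun k => s' k ^ m) fun k =>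
    ⟨pow_pos (hs' k).1 m, pow_lt_one₀ (hs' k).1.le (hs' k).2 hm.ne'⟩
  have hτ_record (hr : r = .record) : Antitone τ :=
    hτanti fun i j hij => pow_le_pow_left₀ (hs' j).1.le (hanti' (hanti hr) hij) m
  obtain ⟨τ', hτ'⟩ := exists_secretarySuccess_ge r D τ hm
  refine ⟨τ', le_trans ?_ hτ'⟩
  have : (0 : ℝ) < m := Nat.cast_pos.2 hm
  have hsum := (pow_mul_value_le_integral_blockCount D r hs' hτ).trans
    (integral_blockCount_le D r hτ_record)
  rw [le_div_iff₀ (by positivity)]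
  calc (r.value s - 1 / m - δ) * (m : ℝ) ^ (n + 1)
      ≤ (r.value s' - 1 / m) * (m : ℝ) ^ (n + 1) := by
        refine mul_le_mul_of_nonneg_right ?_ (by positivity)
        linarith
    _ = m ^ (n + 1) * r.value s' - m ^ n := by
        field_simp
        ring
    _ ≤ _ := sub_le_iff_le_add.2 hsum

end Transfer

lemma exists_antitone_value_eq_optValue (m : ℕ) :
    ∃ s : Fin m → ℝ, (∀ k, s k ∈ Set.Icc 0 1) ∧ Antitone s ∧
      ThresholdRule.record.value s = optValue m 0 :=
  ⟨fun k => optThreshold (m - 1 - k), fun k => optThreshold_mem_Icc _,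
    fun _ _ hij => monotone_optThreshold (Nat.sub_le_sub_left hij _),
    by rw [optValue_eq_recordValue, recordValue_eq_value]⟩

lemma exists_value_ge_iidSuccess (r : ThresholdRule) {m : ℕ} (μ : Measure ℝ)
    [IsProbabilityMeasure μ] [NullSingletonClass μ] (σ : Fin m → ℝ) :
    ∃ s : Fin m → ℝ, (∀ k, s k ∈ Set.Icc 0 1) ∧ (r = .record → Antitone s) ∧
      iidSuccess r μ σ ≤ r.value s := by
  cases r with
  | plain => exact ⟨_, fun k => cdf_mem_Icc μ (σ k), nofun, iidSuccess_plain_le μ σ⟩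
  | record =>
    obtain ⟨s, hs, hanti, hval⟩ := exists_antitone_value_eq_optValue m
    exact ⟨s, hs, fun _ => hanti, hval ▸ iidSuccess_record_le_optValue μ σ⟩

lemma exists_secretarySuccess_ge_iidSuccess (r : ThresholdRule) {m : ℕ} (hm : 0 < m)
    (μ : Measure ℝ) [IsProbabilityMeasure μ] [NullSingletonClass μ] (σ : Fin m → ℝ) {n : ℕ}
    (hn : 0 < n) (D : Fin n → Measure ℝ) [∀ i, IsProbabilityMeasure (D i)]
    [∀ i, NullSingletonClass (D i)] {δ : ℝ} (hδ : 0 < δ) :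
    ∃ τ : Fin n → ℝ, iidSuccess r μ σ - 1 / m - δ ≤ secretarySuccess r D τ := by
  obtain ⟨n, rfl⟩ := Nat.exists_eq_add_one.2 hn
  obtain ⟨s, hs, hanti, hval⟩ := exists_value_ge_iidSuccess r μ σ
  obtain ⟨τ, hτ⟩ := exists_secretarySuccess_ge_value D r hm hs hanti hδ
  exact ⟨τ, by linarith⟩

lemma exists_secretarySuccess_ge_optValue {m : ℕ} (hm : 0 < m) {n : ℕ} (hn : 0 < n)
    (D : Fin n → Measure ℝ) [∀ i, IsProbabilityMeasure (D i)] [∀ i, NullSingletonClass (D i)]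
    {δ : ℝ} (hδ : 0 < δ) :
    ∃ τ : Fin n → ℝ, optValue m 0 - 1 / m - δ ≤ secretarySuccess .record D τ := by
  obtain ⟨n, rfl⟩ := Nat.exists_eq_add_one.2 hn
  obtain ⟨s, hs, hanti, hval⟩ := exists_antitone_value_eq_optValue m
  rw [← hval]
  exact exists_secretarySuccess_ge_value D .record hm hs (fun _ => hanti) hδ

lemma secretarySuccess_const (r : ThresholdRule) {n : ℕ} (μ : Measure ℝ) [IsProbabilityMeasure μ]
    (τ : Fin n → ℝ) : secretarySuccess r (fun _ => μ) τ = iidSuccess r μ τ := by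
  have hperm (π : Equiv.Perm (Fin n)) : (Measure.pi fun _ : Fin n => μ).real
      {x | r.SelectsMax τ fun k => x (π k)} = iidSuccess r μ τ :=
    congrArg ENNReal.toReal <| (measurePreserving_arrowCongr' (fun _ => μ) (fun _ => μ) π.symm
      (.refl ℝ) fun _ => .id μ).measure_preimage_equiv {x | r.SelectsMax τ x}
  simp [secretarySuccess, hperm, Fintype.card_perm, n.factorial_ne_zero]

section Limit

variable (μ : Measure ℝ) [IsProbabilityMeasure μ] [NullSingletonClass μ] {k m : ℕ}

lemma iidOptimum_le_optValue (m : ℕ) : iidOptimum μ m ≤ optValue m 0 :=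
  ciSup_le fun σ => iidSuccess_record_le_optValue μ σ

lemma optValue_sub_one_div_le_iidOptimum (hk : 0 < k) (hm : 0 < m) :
    optValue k 0 - 1 / k ≤ iidOptimum μ m := by
  refine le_of_forall_pos_sub_le fun δ hδ => ?_
  obtain ⟨τ, hτ⟩ := exists_secretarySuccess_ge_optValue hk hm (fun _ => μ) hδ
  rw [secretarySuccess_const] at hτ
  exact hτ.trans <| le_ciSup
    ⟨optValue m 0, Set.forall_mem_range.2 (iidSuccess_record_le_optValue μ)⟩ τ

lemma optValue_sub_one_div_le_optValue (hk : 0 < k) (hm : 0 < m) :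
    optValue k 0 - 1 / k ≤ optValue m 0 := by
  have : IsProbabilityMeasure (volume.restrict (Set.Icc (0 : ℝ) 1)) := ⟨by simp⟩
  exact (optValue_sub_one_div_le_iidOptimum (volume.restrict (Set.Icc (0 : ℝ) 1)) hk hm).trans
    (iidOptimum_le_optValue _ m)

lemma exists_forall_mem_Icc_optValue :
    ∃ α : ℝ, ∀ m : ℕ, 0 < m → α ∈ Set.Icc (optValue m 0 - 1 / m) (optValue m 0) := by
  refine ⟨⨆ k : ℕ, optValue (k + 1) 0 - 1 / (k + 1 : ℕ), fun m hm => ⟨?_, ?_⟩⟩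
  · obtain ⟨k, rfl⟩ := Nat.exists_eq_add_one.2 hm
    refine le_ciSup (f := fun k : ℕ => optValue (k + 1) 0 - 1 / (k + 1 : ℕ)) ⟨optValue 1 0, ?_⟩ k
    exact Set.forall_mem_range.2 fun k => optValue_sub_one_div_le_optValue k.succ_pos one_pos
  · exact ciSup_le fun k => optValue_sub_one_div_le_optValue k.succ_pos hm

variable {α : ℝ}

lemma tendsto_optValue (hα : ∀ m : ℕ, 0 < m → α ∈ Set.Icc (optValue m 0 - 1 / m) (optValue m 0)) :
    Tendsto (fun m : ℕ => optValue m 0) atTop (𝓝 α) := by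
  have hupper : Tendsto (fun m : ℕ => α + 1 / (m : ℝ)) atTop (𝓝 α) := by
    simpa using tendsto_one_div_atTop_nhds_zero_nat.const_add α
  refine tendsto_of_tendsto_of_tendsto_of_le_of_le' tendsto_const_nhds hupper ?_ ?_
  · filter_upwards [eventually_gt_atTop 0] with m hm using (hα m hm).2
  · filter_upwards [eventually_gt_atTop 0] with m hm using sub_le_iff_le_add.1 (hα m hm).1

lemma tendsto_iidOptimum (hα : Tendsto (fun m : ℕ => optValue m 0) atTop (𝓝 α)) :
    Tendsto (fun m : ℕ => iidOptimum μ m) atTop (𝓝 α) := by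
  have hlower : Tendsto (fun m : ℕ => optValue m 0 - 1 / (m : ℝ)) atTop (𝓝 α) := by
    simpa using hα.sub tendsto_one_div_atTop_nhds_zero_nat
  refine tendsto_of_tendsto_of_tendsto_of_le_of_le' hlower hα ?_
    (Eventually.of_forall fun m => iidOptimum_le_optValue μ m)
  filter_upwards [eventually_gt_atTop 0] with m hm using optValue_sub_one_div_le_iidOptimum μ hm hm

end Limit

theorem mainTheorem7_general :
    (∀ (r : ThresholdRule) (m : ℕ), 0 < m →
      ∀ (μ : Measure ℝ) [IsProbabilityMeasure μ] [NullSingletonClass μ] (σ : Fin m → ℝ) (n : ℕ),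
        0 < n →
      ∀ (D : Fin n → Measure ℝ) [∀ i, IsProbabilityMeasure (D i)] [∀ i, NullSingletonClass (D i)]
        (δ : ℝ), 0 < δ →
        ∃ τ : Fin n → ℝ, iidSuccess r μ σ - 1 / m - δ ≤ secretarySuccess r D τ) ∧
    (∃ αGM : ℝ, (0.5801 : ℝ) ≤ αGM ∧
      (∀ (μ : Measure ℝ) [IsProbabilityMeasure μ] [NullSingletonClass μ],
        Tendsto (fun m : ℕ => iidOptimum μ m) atTop (𝓝 αGM)) ∧
      ∀ (n : ℕ), 0 < n →
      ∀ (D : Fin n → Measure ℝ) [∀ i, IsProbabilityMeasure (D i)] [∀ i, NullSingletonClass (D i)]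
        (δ : ℝ), 0 < δ → ∃ τ : Fin n → ℝ, αGM - δ ≤ secretarySuccess .record D τ) := by
  refine ⟨fun r m hm μ _ _ σ n hn D _ _ δ hδ =>
    exists_secretarySuccess_ge_iidSuccess r hm μ σ hn D hδ, ?_⟩
  obtain ⟨α, hα⟩ := exists_forall_mem_Icc_optValue
  refine ⟨α, ge_of_tendsto (tendsto_optValue hα) eventually_gilbertMosteller_le_optValue,
    fun μ _ _ => tendsto_iidOptimum μ (tendsto_optValue hα), fun n hn D _ _ δ hδ => ?_⟩
  obtain ⟨k, hk⟩ := exists_nat_one_div_lt (half_pos hδ)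
  obtain ⟨τ, hτ⟩ := exists_secretarySuccess_ge_optValue k.succ_pos hn D (half_pos hδ)
  rw [Nat.cast_add_one] at hτ
  exact ⟨τ, by linarith [(hα (k + 1) k.succ_pos).2]⟩

lemma one_div_iidCount_le {γ : ℝ} (h0 : 0 < γ) (h1 : γ < 1) :
    0 < iidCount γ ∧ 1 / (iidCount γ : ℝ) ≤ γ := by
  have hpos : 0 < 2 / γ ^ 2 := by positivity
  refine ⟨Nat.ceil_pos.2 hpos, ?_⟩
  calc 1 / (iidCount γ : ℝ) ≤ 1 / (2 / γ ^ 2) := one_div_le_one_div_of_le hpos (Nat.le_ceil _)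
    _ = γ ^ 2 / 2 := by field_simp
    _ ≤ γ := by nlinarith

theorem mainTheorem7 :
    (∀ (r : ThresholdRule) (γ : ℝ), 0 < γ → γ < 1 →
      ∀ (α : ℝ) (μ : Measure ℝ) [IsProbabilityMeasure μ] [NullSingletonClass μ]
        (σ : Fin (iidCount γ) → ℝ), α ≤ iidSuccess r μ σ →
      ∀ (n : ℕ), 0 < n →
      ∀ (D : Fin n → Measure ℝ) [∀ i, IsProbabilityMeasure (D i)] [∀ i, NullSingletonClass (D i)],
        NoSuperstars (superstarBound γ) D →
        ∃ τ : Fin n → ℝ, α - 13 * γ ≤ secretarySuccess r D τ) ∧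
    (∃ αGM : ℝ, (0.5801 : ℝ) ≤ αGM ∧
      (∀ (μ : Measure ℝ) [IsProbabilityMeasure μ] [NullSingletonClass μ],
        Tendsto (fun m : ℕ => iidOptimum μ m) atTop (𝓝 αGM)) ∧
      ∀ (γ : ℝ), 0 < γ → γ < 1 →
      ∀ (n : ℕ), 0 < n →
      ∀ (D : Fin n → Measure ℝ) [∀ i, IsProbabilityMeasure (D i)] [∀ i, NullSingletonClass (D i)],
        NoSuperstars (superstarBound γ) D →
        ∃ τ : Fin n → ℝ, αGM - 13 * γ ≤ secretarySuccess ThresholdRule.record D τ) := by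
  obtain ⟨htransfer, αGM, hlower, hlim, hrecord⟩ := mainTheorem7_general
  refine ⟨fun r γ h0 h1 α μ _ _ σ hα n hn D _ _ _ => ?_,
    αGM, hlower, hlim, fun γ h0 _ n hn D _ _ _ => ?_⟩
  · obtain ⟨hm, hle⟩ := one_div_iidCount_le h0 h1
    obtain ⟨τ, hτ⟩ := htransfer r _ hm μ σ n hn D γ h0
    exact ⟨τ, by linarith⟩
  · exact hrecord n hn D (13 * γ) (by positivity)
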